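/- Let $k$ be an algebraically closed field of characteristic zero, let $n\ge 1$ and $d_1,\dots,d_n\ge 2$, put $R=k[x_1,\dots,x_n]$, $I=\langle x_1^{d_1},\dots,x_n^{d_n}\rangle$, $A=R/I$, and let $h_i=\dim_k [A]_i$ be the Hilbert function of $A$. A linear form $\ell$ is a Lefschetz element of $A$ if for every $i\ge 0$ the multiplication map $\times\ell\colon [A]_i\to[A]_{i+1}$ is injective or surjective. The non-Lefschetz locus $\mathcal L_I\subseteq(\mathbb P^{n-1})^*$ is the set of points $(a_1:\dots:a_n)$ such that $a_1x_1+\dots+a_nx_n$ is not a Lefschetz element of $A$. Its codimension is the height of the ideal, in $S=k[a_1,\dots,a_n]$, of polynomials vanishing on the affine cone over $\mathcal L_I$, where the cone always contains the origin (so the empty set has codimension $n$). For $i\ge 0$ let $I(\mathcal L_{I,i})\subseteq S$ be the ideal of maximal minors of a matrix representing the $S$-linear map $\times(a_1x_1+\dots+a_nx_n)\colon S\otimes_k[A]_i\to S\otimes_k[A]_{i+1}$ in bases of $[A]_i$ and $[A]_{i+1}$ (a minor of size $0$ is $1$), and let $I(\mathcal L_I)=\bigcap_{i\ge0}I(\mathcal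 L_{I,i})$. (a) If $d_1=\dots=d_n=2$ and $n$ is even, then $\mathcal L_I$ has codimension $2$. (b) In all other cases, except when $n=2$ and $d_1=d_2\ge 3$, $\mathcal L_I$ has codimension $1$. (c) If $d_1=\dots=d_n=d$ with $n$ odd and $d$ even, then $h_{\frac{n(d-1)-1}{2}}=h_{\frac{n(d-1)+1}{2}}$, this number is divisible by $n$, and $$I(\mathcal L_I)=\bigl(a_1^{\alpha}\cdots a_n^{\alpha}\bigr),\qquad \alpha=\tfrac1n\,h_{\frac{n(d-1)-1}{2}}.$$ When $d=2$, one has $h_{\frac{n(d-1)-1}{2}}=\binom{n}{\frac{n-1}{2}}$, so that $\alpha=\frac1n\binom{n}{\frac{n-1}{2}}$. -/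

import Mathlib

open scoped LinearAlgebra.Projectivization TensorProduct

noncomputable section

namespace NonLefschetz

open MvPolynomial

variable {k : Type*} [Field k] {n : ℕ}

/-- The degree `i` component `[A]_i` of `A = R/I`, where `R = k[x_1,…,x_n]`: the classes of the
forms of degree `i`. -/
def gradedPiece (I : Ideal (MvPolynomial (Fin n) k)) (i : ℕ) :
    Submodule k (MvPolynomial (Fin n) k ⧸ I) :=
  (homogeneousSubmodule (Fin n) k i).map (Ideal.Quotient.mkₐ k I).toLinearMap

instance finite_gradedPiece (I : Ideal (MvPolynomial (Fin n) k)) (i : ℕ) :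
    Module.Finite k (gradedPiece I i) :=
  Module.Finite.iff_fg.mpr ((homogeneousSubmodule_fg (Fin n) k i).map _)

/-- The Hilbert function `h_A(i) = dim_k [A]_i` of `A = R/I`. -/
def hilbertFunction (I : Ideal (MvPolynomial (Fin n) k)) (i : ℕ) : ℕ :=
  Module.finrank k (gradedPiece I i)

/-- The linear form `a_1 x_1 + ⋯ + a_n x_n`. -/
def linearForm (a : Fin n → k) : MvPolynomial (Fin n) k := ∑ j, C (a j) * X j

theorem linearForm_isHomogeneous (a : Fin n → k) : (linearForm a).IsHomogeneous 1 :=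
  IsHomogeneous.sum _ _ _ fun j _ => by
    simpa using (isHomogeneous_C (Fin n) (a j)).mul (isHomogeneous_X k j)

/-- The linear map `×ℓ : [A]_i → [A]_{i+1}` given by multiplication by a form `ℓ` of degree one. -/
def mulMap (I : Ideal (MvPolynomial (Fin n) k)) (ℓ : MvPolynomial (Fin n) k)
    (hℓ : ℓ.IsHomogeneous 1) (i : ℕ) : gradedPiece I i →ₗ[k] gradedPiece I (i + 1) :=
  (LinearMap.mulLeft k (Ideal.Quotient.mk I ℓ)).restrict (by
    rintro _ ⟨f, hf, rfl⟩
    refine ⟨ℓ * f, ?_, by simp⟩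
    have hf' : f.IsHomogeneous i := hf
    have h := hℓ.mul hf'
    rwa [add_comm] at h)

/-- A linear form `ℓ` is a (weak) Lefschetz element of `A = R/I` if every multiplication map
`×ℓ : [A]_i → [A]_{i+1}` has maximal rank, i.e. is injective or surjective. -/
def IsLefschetzElement (I : Ideal (MvPolynomial (Fin n) k)) (ℓ : MvPolynomial (Fin n) k)
    (hℓ : ℓ.IsHomogeneous 1) : Prop :=
  ∀ i, Function.Injective (mulMap I ℓ hℓ i) ∨ Function.Surjective (mulMap I ℓ hℓ i)

/-- The non-Lefschetz locus `𝓛_I ⊆ (ℙ^{n-1})^*`: the set of points `(a_1 : ⋯ : a_n)` such that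
`a_1 x_1 + ⋯ + a_n x_n` is not a Lefschetz element of `R/I`. -/
def nonLefschetzLocus (I : Ideal (MvPolynomial (Fin n) k)) : Set (ℙ k (Fin n → k)) :=
  {p | ∃ (a : Fin n → k) (ha : a ≠ 0), Projectivization.mk k a ha = p ∧
    ¬ IsLefschetzElement I (linearForm a) (linearForm_isHomogeneous a)}

/-- The affine cone in `k^n`, with its vertex `0`, over a subset of `ℙ^{n-1}`. -/
def affineCone (Z : Set (ℙ k (Fin n → k))) : Set (Fin n → k) :=
  {a | ∀ ha : a ≠ 0, Projectivization.mk k a ha ∈ Z}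

/-- The codimension in `ℙ^{n-1}` of (the Zariski closure of) a set `Z`: the height of the ideal of
polynomials that vanish on the affine cone over `Z`. The empty set has codimension `n`,
corresponding to dimension `-1`. -/
def projCodim (Z : Set (ℙ k (Fin n → k))) : ℕ∞ :=
  (vanishingIdeal k (affineCone Z)).height

/-- Multiplication by the generic linear form `a_1 x_1 + ⋯ + a_n x_n`, as a map of free modules
`S ⊗ [A]_i → S ⊗ [A]_{i+1}` over `S = k[a_1,…,a_n]`. The polynomial ring `S` in the dual variables
is again `MvPolynomial (Fin n) k`, its variable `X j` now standing for `a_j`. -/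
def genericMulMap (I : Ideal (MvPolynomial (Fin n) k)) (i : ℕ) :
    (MvPolynomial (Fin n) k ⊗[k] gradedPiece I i) →ₗ[MvPolynomial (Fin n) k]
      (MvPolynomial (Fin n) k ⊗[k] gradedPiece I (i + 1)) :=
  ∑ j : Fin n, (X j : MvPolynomial (Fin n) k) •
    (mulMap I (X j) (isHomogeneous_X k j) i).baseChange (MvPolynomial (Fin n) k)

/-- The matrix of linear forms in `a_1,…,a_n` that represents `genericMulMap I i` in bases of
`[A]_i` and `[A]_{i+1}`. -/
def genericMatrix (I : Ideal (MvPolynomial (Fin n) k)) (i : ℕ) :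
    Matrix (Fin (Module.finrank k (gradedPiece I (i + 1))))
      (Fin (Module.finrank k (gradedPiece I i))) (MvPolynomial (Fin n) k) :=
  LinearMap.toMatrix
    ((Module.finBasis k (gradedPiece I i)).baseChange (MvPolynomial (Fin n) k))
    ((Module.finBasis k (gradedPiece I (i + 1))).baseChange (MvPolynomial (Fin n) k))
    (genericMulMap I i)

/-- The ideal generated by the maximal minors of a matrix of size `p × q`, i.e. by the minors of
size `min p q`. (A minor of size `0` is `1`.) -/
def maximalMinorIdeal {S : Type*} [CommRing S] {p q : ℕ} (B : Matrix (Fin p) (Fin q) S) :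
    Ideal S :=
  Ideal.span {f | ∃ (r : Fin (min p q) ↪ Fin p) (c : Fin (min p q) ↪ Fin q),
    f = (B.submatrix r c).det}

/-- The ideal `I(𝓛_{I,i})` of maximal minors of the matrix of multiplication by the generic linear
form from degree `i` to degree `i + 1`. It does not depend on the bases. -/
def locusIdealAt (I : Ideal (MvPolynomial (Fin n) k)) (i : ℕ) : Ideal (MvPolynomial (Fin n) k) :=
  maximalMinorIdeal (genericMatrix I i)

/-- The ideal `I(𝓛_I) = ⋂_{i ≥ 0} I(𝓛_{I,i})` in `S = k[a_1,…,a_n]` that defines the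
non-Lefschetz locus as a scheme. -/
def locusIdeal (I : Ideal (MvPolynomial (Fin n) k)) : Ideal (MvPolynomial (Fin n) k) :=
  ⨅ i : ℕ, locusIdealAt I i

/-- The monomial complete intersection `⟨x_1^{d_1}, …, x_n^{d_n}⟩`. -/
def monomialCI (k : Type*) [Field k] {n : ℕ} (d : Fin n → ℕ) : Ideal (MvPolynomial (Fin n) k) :=
  Ideal.span (Set.range fun j => (X j : MvPolynomial (Fin n) k) ^ d j)

end NonLefschetz

end

/-!
Let `e = ∑ (d_j - 1)` be the socle degree of `A = R/I`. In the bases of monomials outside `I`,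
multiplication by `a_1 x_1 + ⋯ + a_n x_n` has an explicit matrix (`stepMatrix`), and complementing
exponents identifies its transpose with the matrix in the complementary degree
(`stepMatrix_transpose`). So injectivity in degrees `i` with `2 i < e` is all that a Lefschetz
element needs (`isLefschetzElement_of_injective`).

The injectivity comes from `sl₂`: the operator `∑ a_j⁻¹ ((d_j - 1) ∂_j - x_j ∂_j²)` preserves `I`,
and its commutator with multiplication by the linear form is the scalar `2 i - e` on forms of degree
`i`. A string of its powers applied to a kernel element of negative weight has to vanish
(`mem_of_linearForm_mul_mem`). If some coefficients vanish, the same argument with only the other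
variables applies to each part of `A` with fixed exponents of the missing variables.

For the codimension, every point off the coordinate hyperplanes is thus a Lefschetz element. If
`a_j = 0`, multiplication preserves the exponent of `x_j`, and for `d_j` maximal the Hilbert
function of the remaining variables both drops and grows between the degrees involved
(`exists_descent_and_ascent`), so neither injectivity nor surjectivity is possible and the locus
contains a hyperplane. The only failures of this count are the two exceptional cases. For squares in
an even number of variables, one vanishing coefficient is harmless
(`isLefschetzElement_of_squares`), whereas two vanishing coefficients are not.

For the defining ideal, the ideals of maximal minors decrease up to the middle degree
(`locusIdealAt_succ_le`): multiplications by the generic form and by `x_1 + ⋯ + x_n` commute and the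
latter is injective, so that the Laplace expansion of `minorIdeal_le_of_mul_eq` applies. By duality
only the middle degree matters. There the ideal is generated by one determinant, which the torus
action on the variables forces to be a scalar times a monomial; the scalar is the determinant for
`x_1 + ⋯ + x_n`, hence nonzero, and the exponents agree by symmetry (`exists_locusIdealAt_middle`).
-/

noncomputable section

namespace NonLefschetz

open MvPolynomial

/-! ### Ideals of minors -/

section Minors

variable {S : Type*} [CommRing S] {ι κ μ : Type*}

/-- The ideal generated by the `m × m` minors of a matrix. Repeated rows and columns are allowed:
they only add the generator `0`. -/
def minorIdeal (m : ℕ) (B : Matrix ι κ S) : Ideal S :=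
  Ideal.span {f | ∃ (r : Fin m → ι) (c : Fin m → κ), f = (B.submatrix r c).det}

theorem det_submatrix_mem_minorIdeal {m : ℕ} (B : Matrix ι κ S) (r : Fin m → ι) (c : Fin m → κ) :
    (B.submatrix r c).det ∈ minorIdeal m B :=
  Ideal.subset_span ⟨r, c, rfl⟩

theorem minorIdeal_le {m : ℕ} {B : Matrix ι κ S} {J : Ideal S}
    (h : ∀ (r : Fin m → ι) (c : Fin m → κ), (B.submatrix r c).det ∈ J) : minorIdeal m B ≤ J :=
  Ideal.span_le.2 (by rintro _ ⟨r, c, rfl⟩; exact h r c)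

theorem maximalMinorIdeal_eq {p q : ℕ} (B : Matrix (Fin p) (Fin q) S) :
    maximalMinorIdeal B = minorIdeal (min p q) B := by
  apply le_antisymm
  · refine Ideal.span_le.2 ?_
    rintro _ ⟨r, c, rfl⟩
    exact det_submatrix_mem_minorIdeal B r c
  · refine minorIdeal_le fun r c => ?_
    by_cases hr : Function.Injective r
    · by_cases hc : Function.Injective c
      · exact Ideal.subset_span ⟨⟨r, hr⟩, ⟨c, hc⟩, rfl⟩
      · simp only [Function.Injective, not_forall] at hc
        obtain ⟨x, y, hxy, hne⟩ := hc
        rw [Matrix.det_zero_of_column_eq hne (by intro k; simp [hxy])]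
        exact zero_mem _
    · simp only [Function.Injective, not_forall] at hr
      obtain ⟨x, y, hxy, hne⟩ := hr
      rw [Matrix.det_zero_of_row_eq hne (by ext k; simp [hxy])]
      exact zero_mem _

theorem minorIdeal_submatrix_le {ι' κ' : Type*} (m : ℕ) (B : Matrix ι κ S) (r : ι' → ι)
    (c : κ' → κ) : minorIdeal m (B.submatrix r c) ≤ minorIdeal m B :=
  minorIdeal_le fun r' c' => by
    rw [Matrix.submatrix_submatrix]
    exact det_submatrix_mem_minorIdeal B _ _

theorem minorIdeal_transpose_le (m : ℕ) (B : Matrix ι κ S) :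
    minorIdeal m B.transpose ≤ minorIdeal m B :=
  minorIdeal_le fun r c => by
    rw [← Matrix.transpose_submatrix, Matrix.det_transpose]
    exact det_submatrix_mem_minorIdeal B _ _

theorem minorIdeal_transpose (m : ℕ) (B : Matrix ι κ S) :
    minorIdeal m B.transpose = minorIdeal m B :=
  le_antisymm (minorIdeal_transpose_le m B)
    (by simpa using minorIdeal_transpose_le m B.transpose)

/-- The Cauchy–Binet expansion of an alternating map at the columns of a matrix `N`, summed over
all selections of rows rather than over sets of rows, which produces the factor `(#κ)!`. -/
theorem factorial_smul_alternating [Fintype ι] [DecidableEq ι] [Fintype κ] [DecidableEq κ]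
    (g : (ι → S) [⋀^κ]→ₗ[S] S) (N : Matrix ι κ S) :
    ((Fintype.card κ).factorial : S) * g N.transpose =
      ∑ f : κ → ι, (N.submatrix f id).det * g fun c => Pi.single (f c) 1 := by
  have hN : g N.transpose =
      ∑ f : κ → ι, (∏ c, N (f c) c) * g fun c => Pi.single (f c) 1 := by
    have h1 : N.transpose = fun c => ∑ r, N r c • (Pi.single r 1 : ι → S) := by
      ext c r
      simp [Finset.sum_apply, Pi.single_apply]
    conv_lhs => rw [h1]
    rw [← AlternatingMap.coe_multilinearMap, MultilinearMap.map_sum]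
    refine Finset.sum_congr rfl fun f _ => ?_
    rw [MultilinearMap.map_smul_univ, smul_eq_mul]
  -- reindexing the selections by `σ` absorbs the sign, so each `σ` contributes the same sum
  have hσ : ∀ σ : Equiv.Perm κ,
      ∑ f : κ → ι, (((Equiv.Perm.sign σ : ℤ) : S) * ∏ c, N (f (σ c)) c) *
        g (fun c => Pi.single (f c) 1) = g N.transpose := by
    intro σ
    rw [hN]
    refine Fintype.sum_equiv (Equiv.arrowCongr σ.symm (Equiv.refl ι)) _ _ fun f => ?_
    have h2 := g.map_perm (fun c => (Pi.single (f c) 1 : ι → S)) σ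
    have h3 : g (fun c => (Pi.single (f (σ c)) 1 : ι → S)) =
        ((Equiv.Perm.sign σ : ℤ) : S) * g (fun c => Pi.single (f c) 1) := by
      have := h2
      simp only [Function.comp_def] at this
      rw [this, Units.smul_def, zsmul_eq_mul]
    simp only [Equiv.arrowCongr_apply, Equiv.symm_symm, Equiv.coe_refl, Function.comp_def, id]
    rw [h3]
    ring
  have hs : ∑ σ : Equiv.Perm κ, ∑ f : κ → ι,
      (((Equiv.Perm.sign σ : ℤ) : S) * ∏ c, N (f (σ c)) c) * g (fun c => Pi.single (f c) 1) =
      ((Fintype.card κ).factorial : S) * g N.transpose := by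
    rw [Finset.sum_congr rfl fun σ _ => hσ σ]
    simp [Fintype.card_perm]
  rw [← hs, Finset.sum_comm]
  refine Finset.sum_congr rfl fun f _ => ?_
  rw [Matrix.det_apply', Finset.sum_mul]
  rfl

variable {k : Type*} [Field k]

theorem alternating_mem_minorIdeal (k : Type*) [Field k] [CharZero k] [Algebra k S]
    [Fintype ι] [Fintype κ] (g : (ι → S) [⋀^κ]→ₗ[S] S) (N : Matrix ι κ S) :
    g N.transpose ∈ minorIdeal (Fintype.card κ) N := by
  classical
  have hu : IsUnit ((Fintype.card κ).factorial : S) := by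
    have := (Nat.cast_ne_zero (R := k)).2 (Nat.factorial_ne_zero (Fintype.card κ))
    simpa using (IsUnit.mk0 _ this).map (algebraMap k S)
  rw [← Ideal.unit_mul_mem_iff_mem _ hu, factorial_smul_alternating]
  refine Ideal.sum_mem _ fun f _ => Ideal.mul_mem_right _ _ ?_
  have e := (Fintype.equivFin κ).symm
  rw [← Matrix.det_submatrix_equiv_self e, Matrix.submatrix_submatrix]
  exact det_submatrix_mem_minorIdeal N _ _

theorem minorIdeal_mul_left_le (k : Type*) [Field k] [CharZero k] [Algebra k S] {ι' : Type*}
    [Fintype ι] (m : ℕ) (P : Matrix ι' ι S) (B : Matrix ι κ S) :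
    minorIdeal m (P * B) ≤ minorIdeal m B :=
  minorIdeal_le fun r c => by
    classical
    have h := alternating_mem_minorIdeal k
      (Matrix.detRowAlternating.compLinearMap (P.submatrix r id).mulVecLin) (B.submatrix id c)
    rw [Fintype.card_fin] at h
    refine minorIdeal_submatrix_le m B id c ?_
    convert h using 1
    rw [← Matrix.det_transpose]
    rfl

theorem minorIdeal_mul_right_le (k : Type*) [Field k] [CharZero k] [Algebra k S] {κ' : Type*}
    [Fintype κ] (m : ℕ) (B : Matrix ι κ S) (Q : Matrix κ κ' S) :
    minorIdeal m (B * Q) ≤ minorIdeal m B := by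
  rw [← minorIdeal_transpose, Matrix.transpose_mul, ← minorIdeal_transpose m B]
  exact minorIdeal_mul_left_le k m _ _

/-- The determinant of a square matrix as an alternating function of some of its columns, the
vectors `w x` being first transformed by a linear map. -/
def partialDet {V ν : Type*} [AddCommGroup V] [Module S V] [Fintype μ] [Fintype ν]
    [DecidableEq μ] [DecidableEq ν] (L : V →ₗ[S] (μ ⊕ ν → S)) (y : ν → μ ⊕ ν → S) :
    V [⋀^μ]→ₗ[S] S where
  toFun w := Matrix.detRowAlternating (Sum.elim (fun x => L (w x)) y)
  map_update_add' {hd} w x a b := by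
    have key : ∀ z : V, (Sum.elim (fun t => L (@Function.update _ _ hd w x z t)) y) =
        Function.update (Sum.elim (fun t => L (w t)) y) (Sum.inl x) (L z) := by
      intro z
      ext t : 1
      rcases t with t | t
      · by_cases h : t = x
        · subst h; simp
        · simp [h]
      · simp
    rw [key, key, key, map_add, AlternatingMap.map_update_add]
  map_update_smul' {hd} w x a b := by
    have key : ∀ z : V, (Sum.elim (fun t => L (@Function.update _ _ hd w x z t)) y) =
        Function.update (Sum.elim (fun t => L (w t)) y) (Sum.inl x) (L z) := by
      intro z
      ext t : 1
      rcases t with t | t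
      · by_cases h : t = x
        · subst h; simp
        · simp [h]
      · simp
    rw [key, key, map_smul, AlternatingMap.map_update_smul]
  map_eq_zero_of_eq' w x x' h hne := by
    refine AlternatingMap.map_eq_zero_of_eq _ _ (i := Sum.inl x) (j := Sum.inl x') ?_ (by simpa)
    simp [h]

theorem exists_basis_sum_extending {V : Type*} [AddCommGroup V] [Module k V] {v : μ → V}
    (hv : LinearIndependent k v) :
    ∃ (ν : Set V) (b : Module.Basis (μ ⊕ ν) k V), ∀ x, b (Sum.inl x) = v x := by
  classical
  have hs := hv.linearIndepOn_id
  refine ⟨hs.extend (Set.subset_univ _) \ Set.range v, (Module.Basis.extend hs).reindex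
    ((Equiv.sumCongr (Equiv.ofInjective v hv.injective) (Equiv.refl _)).trans
      (Equiv.Set.sumDiffSubset (hs.subset_extend (Set.subset_univ _)))).symm, fun x => ?_⟩
  simp

/-- If `M T = T' N` where `T` has scalar entries and linearly independent columns, then
the maximal minors of `M` (all columns) lie in the ideal of maximal minors of `N` (all columns):
completing the columns of `T` to a basis, the first columns of `M` become combinations of the
columns of `N`. -/
theorem minorIdeal_le_of_mul_eq [CharZero k] [Algebra k S] [Fintype ι] [Fintype κ]
    [Fintype μ] (M : Matrix ι κ S) (N : Matrix κ μ S) (T : Matrix κ μ k) (T' : Matrix ι κ S)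
    (hT : Function.Injective T.mulVec)
    (h : M * T.map (algebraMap k S) = T' * N) :
    minorIdeal (Fintype.card κ) M ≤ minorIdeal (Fintype.card μ) N := by
  classical
  refine minorIdeal_le fun r c => ?_
  by_cases hc : Function.Injective c
  swap
  · simp only [Function.Injective, not_forall] at hc
    obtain ⟨x, y, hxy, hne⟩ := hc
    rw [Matrix.det_zero_of_column_eq hne (by intro k; simp [hxy])]
    exact zero_mem _
  have hcb : Function.Bijective c :=
    (Fintype.bijective_iff_injective_and_card c).2 ⟨hc, by simp⟩
  have hli : LinearIndependent k T.col := Matrix.mulVec_injective_iff.1 hT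
  obtain ⟨ν, b, hb⟩ := exists_basis_sum_extending hli
  have hfin : Finite (μ ⊕ ν) := Module.Finite.finite_basis b
  have : Finite ν := Finite.sum_right μ
  have := Fintype.ofFinite ν
  have hcard : Fintype.card (μ ⊕ ν) = Fintype.card κ := by
    rw [← Module.finrank_eq_card_basis b, Module.finrank_fintype_fun_eq_card]
  let e : μ ⊕ ν ≃ Fin (Fintype.card κ) := Fintype.equivFinOfCardEq hcard
  -- `W` completes the columns of `T` to an invertible matrix
  let W : Matrix κ (μ ⊕ ν) k := (Pi.basisFun k κ).toMatrix b
  have hW : ∀ x : μ, ∀ t, W t (Sum.inl x) = T t x := by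
    intro x t
    simp only [W, Module.Basis.toMatrix_apply, Pi.basisFun_repr]
    rw [hb]
    rfl
  have hWinv : (b.toMatrix (Pi.basisFun k κ)) * W = 1 := Module.Basis.toMatrix_mul_toMatrix_flip _ _
  have hdet : IsUnit (W.submatrix (c ∘ e) id).det := by
    have h1 : ((b.toMatrix (Pi.basisFun k κ)).submatrix id (c ∘ e)) *
        (W.submatrix (c ∘ e) id) = 1 := by
      have := Matrix.submatrix_mul_equiv (b.toMatrix (Pi.basisFun k κ)) W id
        (e.trans (Equiv.ofBijective c hcb)) id
      simpa [hWinv] using this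
    have h2 := congrArg Matrix.det h1
    rw [Matrix.det_mul, Matrix.det_one] at h2
    exact IsUnit.of_mul_eq_one_right _ h2
  have hdetS : IsUnit ((W.map (algebraMap k S)).submatrix (c ∘ e) id).det := by
    have := hdet.map (algebraMap k S)
    rwa [RingHom.map_det] at this
  have hmem := alternating_mem_minorIdeal k
    (partialDet (T'.submatrix (r ∘ e) id).mulVecLin
      (fun y => ((M * W.map (algebraMap k S)).submatrix (r ∘ e) id).transpose (Sum.inr y))) N
  rw [← Ideal.mul_unit_mem_iff_mem _ hdetS]
  convert hmem using 1
  have h3 : (M.submatrix r c).det = (M.submatrix (r ∘ e) (c ∘ e)).det := by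
    rw [← Matrix.det_submatrix_equiv_self e, Matrix.submatrix_submatrix]
  rw [h3, ← Matrix.det_mul]
  have h4 := Matrix.submatrix_mul_equiv M (W.map (algebraMap k S)) (r ∘ e)
    (e.trans (Equiv.ofBijective c hcb)) id
  have h5 : M.submatrix (r ∘ e) (c ∘ e) * (W.map (algebraMap k S)).submatrix (c ∘ e) id =
    (M * W.map (algebraMap k S)).submatrix (r ∘ e) id := h4
  rw [h5, ← Matrix.det_transpose]
  change Matrix.detRowAlternating _ = Matrix.detRowAlternating _
  congr 1
  ext t s
  rcases t with x | y
  · have h6 : (M * W.map (algebraMap k S)) (r (e s)) (Sum.inl x) =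
        (M * T.map (algebraMap k S)) (r (e s)) x := by
      simp [Matrix.mul_apply, hW]
    simp only [Matrix.transpose_apply, Matrix.submatrix_apply, Function.comp_apply, id,
      Sum.elim_inl]
    rw [h6, h]
    rfl
  · rfl

end Minors

/-! ### Monomial bases and the matrices of multiplication by a linear form -/

section MonomialBasis

variable {k : Type*} [Field k] {n : ℕ} {d : Fin n → ℕ}

theorem monomialCI_eq (k : Type*) [Field k] (d : Fin n → ℕ) :
    monomialCI k d =
      Ideal.span ((fun s => monomial s (1 : k)) '' Set.range fun j => Finsupp.single j (d j)) := by
  rw [monomialCI, ← Set.range_comp]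
  congr 2
  ext j
  simp [X_pow_eq_monomial]

theorem mem_monomialCI_iff {f : MvPolynomial (Fin n) k} :
    f ∈ monomialCI k d ↔ ∀ v ∈ f.support, ∃ j, d j ≤ v j := by
  rw [monomialCI_eq, mem_ideal_span_monomial_image]
  simp

/-- The exponents of the monomials of degree `i` outside `⟨x_1^{d_1}, …, x_n^{d_n}⟩`. -/
def boxLevel (d : Fin n → ℕ) (i : ℕ) : Finset (Fin n →₀ ℕ) :=
  (Finset.univ.finsuppAntidiag i).filter fun v => ∀ j, v j < d j

theorem mem_boxLevel {i : ℕ} {v : Fin n →₀ ℕ} :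
    v ∈ boxLevel d i ↔ ∑ j, v j = i ∧ ∀ j, v j < d j := by
  simp [boxLevel, Finset.mem_finsuppAntidiag]

/-- The matrix, in the monomial bases, of multiplication by `a_1 x_1 + ⋯ + a_n x_n` from degree `i`
to degree `i + 1` of the monomial complete intersection with exponents `d`. -/
def stepMatrix {S : Type*} [CommRing S] (d : Fin n → ℕ) (a : Fin n → S) (i : ℕ) :
    Matrix (boxLevel d (i + 1)) (boxLevel d i) S :=
  fun u v => ∑ j, if u.1 = v.1 + Finsupp.single j 1 then a j else 0

/-- The class of a monomial of degree `i` outside the ideal. -/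
def boxClass (k : Type*) [Field k] (d : Fin n → ℕ) (i : ℕ) (v : boxLevel d i) :
    gradedPiece (monomialCI k d) i :=
  ⟨Ideal.Quotient.mk _ (monomial v.1 1), monomial v.1 1, by
    refine isHomogeneous_monomial _ ?_
    rw [Finsupp.degree_eq_sum]
    exact (mem_boxLevel.1 v.2).1, rfl⟩

theorem linearIndependent_boxClass (k : Type*) [Field k] (d : Fin n → ℕ) (i : ℕ) :
    LinearIndependent k (boxClass k d i) := by
  rw [Fintype.linearIndependent_iff]
  intro c hc v
  have h : (∑ v, monomial v.1 (c v) : MvPolynomial (Fin n) k) ∈ monomialCI k d := by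
    rw [← Ideal.Quotient.eq_zero_iff_mem, map_sum]
    have := congrArg Subtype.val hc
    simp only [Submodule.coe_sum, Submodule.coe_smul, Submodule.coe_zero] at this
    rw [← this]
    refine Finset.sum_congr rfl fun v _ => ?_
    have hm : (monomial v.1 (c v) : MvPolynomial (Fin n) k) = c v • monomial v.1 1 := by
      simp [smul_monomial]
    rw [hm]
    rfl
  by_contra hv
  have hcoef : coeff v.1 (∑ v, monomial v.1 (c v) : MvPolynomial (Fin n) k) = c v := by
    rw [coeff_sum, Finset.sum_eq_single v]
    · simp
    · intro w _ hw
      rw [coeff_monomial, if_neg]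
      exact fun h => hw (Subtype.ext h)
    · simp
  obtain ⟨j, hj⟩ := mem_monomialCI_iff.1 h v.1 (by rw [mem_support_iff, hcoef]; exact hv)
  exact absurd ((mem_boxLevel.1 v.2).2 j) (not_lt.2 hj)

theorem span_boxClass (k : Type*) [Field k] (d : Fin n → ℕ) (i : ℕ) :
    ⊤ ≤ Submodule.span k (Set.range (boxClass k d i)) := by
  rintro ⟨_, f, hf, rfl⟩ -
  have hf' : f.IsHomogeneous i := hf
  set U := Submodule.span k (Set.range (boxClass k d i))
  suffices h : (Ideal.Quotient.mkₐ k (monomialCI k d)).toLinearMap f ∈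
      U.map (gradedPiece (monomialCI k d) i).subtype by
    obtain ⟨x, hx, hxf⟩ := h
    have hx' : (⟨(Ideal.Quotient.mkₐ k (monomialCI k d)).toLinearMap f, f, hf, rfl⟩ :
        gradedPiece (monomialCI k d) i) = x := Subtype.ext hxf.symm
    exact hx' ▸ hx
  rw [f.as_sum, map_sum]
  refine Submodule.sum_mem _ fun v hv => ?_
  by_cases hbox : ∀ j, v j < d j
  · have hvd : v ∈ boxLevel d i := by
      refine mem_boxLevel.2 ⟨?_, hbox⟩
      rw [← Finsupp.degree_eq_sum]
      by_contra hne
      exact (mem_support_iff.1 hv) (hf'.coeff_eq_zero hne)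
    have hm : (monomial v (coeff v f) : MvPolynomial (Fin n) k) = coeff v f • monomial v 1 := by
      simp [smul_monomial]
    rw [hm, map_smul]
    exact Submodule.smul_mem _ _ ⟨boxClass k d i ⟨v, hvd⟩, Submodule.subset_span ⟨_, rfl⟩, rfl⟩
  · push Not at hbox
    obtain ⟨j, hj⟩ := hbox
    have hz : (Ideal.Quotient.mkₐ k (monomialCI k d)).toLinearMap (monomial v (coeff v f)) = 0 := by
      refine Ideal.Quotient.eq_zero_iff_mem.2 (mem_monomialCI_iff.2 fun w hw => ?_)
      have := support_monomial_subset hw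
      rw [Finset.mem_singleton] at this
      exact ⟨j, this ▸ hj⟩
    rw [hz]
    exact zero_mem _

/-- The monomial basis of the degree `i` component of a monomial complete intersection. -/
def boxBasis (k : Type*) [Field k] (d : Fin n → ℕ) (i : ℕ) :
    Module.Basis (boxLevel d i) k (gradedPiece (monomialCI k d) i) :=
  Module.Basis.mk (linearIndependent_boxClass k d i) (span_boxClass k d i)

theorem hilbertFunction_monomialCI (k : Type*) [Field k] (d : Fin n → ℕ) (i : ℕ) :
    hilbertFunction (monomialCI k d) i = (boxLevel d i).card := by
  rw [hilbertFunction, Module.finrank_eq_card_basis (boxBasis k d i), Fintype.card_coe]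

theorem mulMap_eq_toLin {a : Fin n → k} {ℓ : MvPolynomial (Fin n) k} (hℓ : ℓ.IsHomogeneous 1)
    (h : ℓ = linearForm a) (i : ℕ) :
    mulMap (monomialCI k d) ℓ hℓ i =
      Matrix.toLin (boxBasis k d i) (boxBasis k d (i + 1)) (stepMatrix d a i) := by
  subst h
  refine (boxBasis k d i).ext fun v => Subtype.ext ?_
  rw [Matrix.toLin_self, Submodule.coe_sum]
  have hb : ∀ i (v : boxLevel d i), (boxBasis k d i v : MvPolynomial (Fin n) k ⧸ monomialCI k d) =
      Ideal.Quotient.mk _ (monomial v.1 1) := by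
    intro i v
    simp [boxBasis, boxClass]
  have hl : ((mulMap (monomialCI k d) (linearForm a) hℓ i (boxBasis k d i v) :
      gradedPiece (monomialCI k d) (i + 1)) : MvPolynomial (Fin n) k ⧸ monomialCI k d) =
      Ideal.Quotient.mk _ (linearForm a * monomial v.1 1) := by
    rw [map_mul, ← hb]
    rfl
  rw [hl, linearForm, Finset.sum_mul, map_sum]
  have hr : ∀ u : boxLevel d (i + 1),
      ((stepMatrix d a i u v • boxBasis k d (i + 1) u : gradedPiece (monomialCI k d) (i + 1)) :
        MvPolynomial (Fin n) k ⧸ monomialCI k d) =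
      ∑ j, if u.1 = v.1 + Finsupp.single j 1 then
        Ideal.Quotient.mk _ (a j • (monomial u.1 1 : MvPolynomial (Fin n) k)) else 0 := by
    intro u
    rw [Submodule.coe_smul, hb, stepMatrix, Finset.sum_smul]
    refine Finset.sum_congr rfl fun j _ => ?_
    split_ifs
    · rfl
    · simp
  rw [Finset.sum_congr rfl fun u _ => hr u, Finset.sum_comm]
  refine Finset.sum_congr rfl fun j _ => ?_
  have hm : (C (a j) * X j * monomial v.1 1 : MvPolynomial (Fin n) k) =
      a j • monomial (v.1 + Finsupp.single j 1) 1 := by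
    rw [mul_assoc, ← pow_one (X j : MvPolynomial (Fin n) k), X_pow_eq_monomial, monomial_mul,
      add_comm, mul_one, MvPolynomial.smul_eq_C_mul]
  rw [hm]
  by_cases hw : v.1 + Finsupp.single j 1 ∈ boxLevel d (i + 1)
  · rw [Finset.sum_eq_single ⟨_, hw⟩]
    · simp
    · intro u _ hu
      rw [if_neg]
      exact fun h => hu (Subtype.ext h)
    · simp
  · rw [Finset.sum_eq_zero]
    · refine Ideal.Quotient.eq_zero_iff_mem.2 (mem_monomialCI_iff.2 fun w hw' => ?_)
      have h1 := support_smul hw'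
      have h2 := Finset.mem_singleton.1 (support_monomial_subset h1)
      subst h2
      by_contra hcon
      push Not at hcon
      refine hw (mem_boxLevel.2 ⟨?_, hcon⟩)
      have := (mem_boxLevel.1 v.2).1
      simp [Finset.sum_add_distrib, this, Finsupp.single_apply]
    · intro u _
      rw [if_neg]
      exact fun h => hw (h ▸ u.2)

theorem mulMap_injective_iff (a : Fin n → k) (i : ℕ) :
    Function.Injective (mulMap (monomialCI k d) (linearForm a) (linearForm_isHomogeneous a) i) ↔
      Function.Injective (stepMatrix d a i).mulVec := by
  rw [mulMap_eq_toLin _ rfl]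
  have h : ⇑(Matrix.toLin (boxBasis k d i) (boxBasis k d (i + 1)) (stepMatrix d a i)) =
      (boxBasis k d (i + 1)).equivFun.symm ∘ (stepMatrix d a i).mulVec ∘
        (boxBasis k d i).equivFun := by
    ext x : 1
    simp [Matrix.toLin_apply, Module.Basis.equivFun_symm_apply]
  rw [h, EquivLike.comp_injective, EquivLike.injective_comp]

theorem mulMap_surjective_iff (a : Fin n → k) (i : ℕ) :
    Function.Surjective (mulMap (monomialCI k d) (linearForm a) (linearForm_isHomogeneous a) i) ↔
      Function.Surjective (stepMatrix d a i).mulVec := by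
  rw [mulMap_eq_toLin _ rfl]
  have h : ⇑(Matrix.toLin (boxBasis k d i) (boxBasis k d (i + 1)) (stepMatrix d a i)) =
      (boxBasis k d (i + 1)).equivFun.symm ∘ (stepMatrix d a i).mulVec ∘
        (boxBasis k d i).equivFun := by
    ext x : 1
    simp [Matrix.toLin_apply, Module.Basis.equivFun_symm_apply]
  rw [h, EquivLike.comp_surjective, EquivLike.surjective_comp]

/-- The complement `v ↦ (d_j - 1 - v_j)_j` of exponents, which is the Gorenstein duality of the
monomial complete intersection. -/
def complementExp (d : Fin n → ℕ) (v : Fin n →₀ ℕ) : Fin n →₀ ℕ :=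
  Finsupp.equivFunOnFinite.symm fun j => d j - 1 - v j

@[simp]
theorem complementExp_apply (v : Fin n →₀ ℕ) (j : Fin n) :
    complementExp d v j = d j - 1 - v j := rfl

theorem complementExp_mem {i i' : ℕ} (hi : i + i' = ∑ j, (d j - 1)) {v : Fin n →₀ ℕ}
    (hv : v ∈ boxLevel d i) : complementExp d v ∈ boxLevel d i' := by
  obtain ⟨h1, h2⟩ := mem_boxLevel.1 hv
  refine mem_boxLevel.2 ⟨?_, fun j => ?_⟩
  · have h3 : ∑ j, complementExp d v j + ∑ j, v j = ∑ j, (d j - 1) := by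
      rw [← Finset.sum_add_distrib]
      refine Finset.sum_congr rfl fun j _ => ?_
      have := h2 j
      simp only [complementExp_apply]
      omega
    omega
  · have := h2 j
    simp only [complementExp_apply]
    omega

theorem complementExp_complementExp {i : ℕ} {v : Fin n →₀ ℕ} (hv : v ∈ boxLevel d i) :
    complementExp d (complementExp d v) = v := by
  ext j
  have := (mem_boxLevel.1 hv).2 j
  simp only [complementExp_apply]
  omega

/-- Monomials of complementary degrees correspond to each other. -/
def complementEquiv {i i' : ℕ} (hi : i + i' = ∑ j, (d j - 1)) : boxLevel d i ≃ boxLevel d i' where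
  toFun v := ⟨complementExp d v.1, complementExp_mem hi v.2⟩
  invFun v := ⟨complementExp d v.1, complementExp_mem (by omega) v.2⟩
  left_inv v := Subtype.ext (complementExp_complementExp v.2)
  right_inv v := Subtype.ext (complementExp_complementExp v.2)

theorem card_boxLevel_symm {i i' : ℕ} (hi : i + i' = ∑ j, (d j - 1)) :
    (boxLevel d i).card = (boxLevel d i').card := by
  simpa using Fintype.card_congr (complementEquiv hi)

/-- Duality exchanges multiplication from degree `i` to `i + 1` with its transpose from degree
`e - i - 1` to `e - i`, where `e` is the socle degree. -/
theorem stepMatrix_transpose {S : Type*} [CommRing S] (a : Fin n → S) {i i' : ℕ}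
    (hi : i + 1 + i' = ∑ j, (d j - 1)) (hi' : i + (i' + 1) = ∑ j, (d j - 1)) :
    (stepMatrix d a i).transpose =
      (stepMatrix d a i').submatrix (complementEquiv hi') (complementEquiv hi) := by
  ext v u
  simp only [Matrix.transpose_apply, Matrix.submatrix_apply, stepMatrix]
  refine Finset.sum_congr rfl fun j _ => ?_
  congr 1
  have hv := (mem_boxLevel.1 v.2).2
  have hu := (mem_boxLevel.1 u.2).2
  simp only [complementEquiv, Equiv.coe_fn_mk, eq_iff_iff, Finsupp.ext_iff, Finsupp.add_apply,
    complementExp_apply]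
  refine forall_congr' fun l => ?_
  have h1 := hv l
  have h2 := hu l
  omega

theorem stepMatrix_ne_zero {S : Type*} [CommRing S] {a : Fin n → S} {i : ℕ}
    {u : boxLevel d (i + 1)} {v : boxLevel d i} (h : stepMatrix d a i u v ≠ 0) :
    ∃ j, u.1 = v.1 + Finsupp.single j 1 ∧ a j ≠ 0 := by
  obtain ⟨j, -, hj⟩ := Finset.exists_ne_zero_of_sum_ne_zero h
  by_cases hu : u.1 = v.1 + Finsupp.single j 1
  · exact ⟨j, hu, by simpa [hu] using hj⟩
  · simp [hu] at hj

/-- Multiplications by two linear forms commute. -/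
theorem stepMatrix_mul_comm {S : Type*} [CommRing S] (a b : Fin n → S) (i : ℕ) :
    stepMatrix d a (i + 1) * stepMatrix d b i = stepMatrix d b (i + 1) * stepMatrix d a i := by
  have key : ∀ (a b : Fin n → S) (u : boxLevel d (i + 1 + 1)) (w : boxLevel d i),
      (stepMatrix d a (i + 1) * stepMatrix d b i) u w = ∑ j, ∑ l,
        if u.1 = w.1 + Finsupp.single l 1 + Finsupp.single j 1 then a j * b l else 0 := by
    intro a b u w
    simp only [Matrix.mul_apply, stepMatrix, Finset.sum_mul_sum]
    rw [Finset.sum_comm]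
    refine Finset.sum_congr rfl fun j _ => ?_
    rw [Finset.sum_comm]
    refine Finset.sum_congr rfl fun l _ => ?_
    by_cases hu : u.1 = w.1 + Finsupp.single l 1 + Finsupp.single j 1
    · have hmem : w.1 + Finsupp.single l 1 ∈ boxLevel d (i + 1) := by
        refine mem_boxLevel.2 ⟨?_, fun m => ?_⟩
        · have := (mem_boxLevel.1 w.2).1
          simp [Finset.sum_add_distrib, this, Finsupp.single_apply]
        · have := (mem_boxLevel.1 u.2).2 m
          rw [hu, Finsupp.add_apply] at this
          omega
      rw [Finset.sum_eq_single ⟨_, hmem⟩]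
      · simp [hu]
      · intro v _ hv
        have : v.1 ≠ w.1 + Finsupp.single l 1 := fun h => hv (Subtype.ext h)
        simp [this]
      · simp
    · rw [if_neg hu]
      refine Finset.sum_eq_zero fun v _ => ?_
      by_cases hv : v.1 = w.1 + Finsupp.single l 1
      · rw [← hv] at hu
        simp [hu]
      · simp [hv]
  ext u w
  rw [key, key, Finset.sum_comm]
  refine Finset.sum_congr rfl fun j _ => Finset.sum_congr rfl fun l _ => ?_
  rw [add_right_comm w.1, mul_comm]

theorem stepMatrix_map {R S : Type*} [CommRing R] [CommRing S] (φ : R →+* S) (a : Fin n → R)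
    (i : ℕ) : (stepMatrix d a i).map φ = stepMatrix d (fun j => φ (a j)) i := by
  ext u v
  simp [stepMatrix, apply_ite φ]

/-- The torus action: after rescaling the monomial bases, the generic matrix becomes scalar. -/
theorem stepMatrix_X_mul_monomial (i : ℕ) (u : boxLevel d (i + 1)) (v : boxLevel d i) :
    stepMatrix d (X : Fin n → MvPolynomial (Fin n) k) i u v * monomial v.1 1 =
      monomial u.1 1 * C (stepMatrix d (fun _ => (1 : k)) i u v) := by
  rw [stepMatrix, stepMatrix, map_sum, Finset.sum_mul, Finset.mul_sum]
  refine Finset.sum_congr rfl fun j _ => ?_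
  split_ifs with h
  · rw [h, C_1, mul_one, ← pow_one (X j : MvPolynomial (Fin n) k), X_pow_eq_monomial, monomial_mul,
      add_comm, mul_one]
  · simp

theorem genericMulMap_toMatrix (i : ℕ) :
    LinearMap.toMatrix ((boxBasis k d i).baseChange (MvPolynomial (Fin n) k))
      ((boxBasis k d (i + 1)).baseChange (MvPolynomial (Fin n) k))
      (genericMulMap (monomialCI k d) i) =
    stepMatrix d (X : Fin n → MvPolynomial (Fin n) k) i := by
  rw [genericMulMap, map_sum]
  have h : ∀ j : Fin n, mulMap (monomialCI k d) (X j) (isHomogeneous_X k j) i =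
      Matrix.toLin (boxBasis k d i) (boxBasis k d (i + 1)) (stepMatrix d (Pi.single j 1) i) := by
    intro j
    refine mulMap_eq_toLin _ ?_ i
    rw [linearForm, Finset.sum_eq_single j]
    · simp
    · intro l _ hl
      simp [hl]
    · simp
  ext1 u v
  rw [Matrix.sum_apply, stepMatrix]
  refine Finset.sum_congr rfl fun j _ => ?_
  rw [map_smul, Matrix.smul_apply]
  rw [h j]
  have h2 : LinearMap.toMatrix ((boxBasis k d i).baseChange (MvPolynomial (Fin n) k))
      ((boxBasis k d (i + 1)).baseChange (MvPolynomial (Fin n) k))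
      ((Matrix.toLin (boxBasis k d i) (boxBasis k d (i + 1))
        (stepMatrix d (Pi.single j 1) i)).baseChange (MvPolynomial (Fin n) k)) u v =
      algebraMap k _ (stepMatrix d (Pi.single j 1) i u v) := by
    conv_rhs => rw [← LinearMap.toMatrix_toLin (boxBasis k d i) (boxBasis k d (i + 1))
      (stepMatrix d (Pi.single j 1) i)]
    simp only [LinearMap.toMatrix_apply, Module.Basis.baseChange_apply,
      LinearMap.baseChange_tmul, Module.Basis.baseChange_repr_tmul, Algebra.algebraMap_eq_smul_one]
  rw [h2, stepMatrix, Finset.sum_eq_single j]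
  · split_ifs <;> simp
  · intro l _ hl
    simp [hl]
  · simp

theorem locusIdealAt_monomialCI [CharZero k] (i : ℕ) :
    locusIdealAt (monomialCI k d) i =
      minorIdeal (min (boxLevel d (i + 1)).card (boxLevel d i).card)
        (stepMatrix d (X : Fin n → MvPolynomial (Fin n) k) i) := by
  classical
  rw [locusIdealAt, maximalMinorIdeal_eq]
  have h1 : ∀ i, Module.finrank k (gradedPiece (monomialCI k d) i) = (boxLevel d i).card :=
    hilbertFunction_monomialCI k d
  set b := fun i => (boxBasis k d i).baseChange (MvPolynomial (Fin n) k)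
  set c := fun i => (Module.finBasis k (gradedPiece (monomialCI k d) i)).baseChange
    (MvPolynomial (Fin n) k)
  rw [← genericMulMap_toMatrix]
  have e1 : genericMatrix (monomialCI k d) i = (c (i + 1)).toMatrix (b (i + 1)) *
      LinearMap.toMatrix (b i) (b (i + 1)) (genericMulMap (monomialCI k d) i) *
        (b i).toMatrix (c i) :=
    (basis_toMatrix_mul_linearMap_toMatrix_mul_basis_toMatrix _ _ _ _ _).symm
  have e2 : LinearMap.toMatrix (b i) (b (i + 1)) (genericMulMap (monomialCI k d) i) =
      (b (i + 1)).toMatrix (c (i + 1)) * genericMatrix (monomialCI k d) i *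
        (c i).toMatrix (b i) :=
    (basis_toMatrix_mul_linearMap_toMatrix_mul_basis_toMatrix _ _ _ _ _).symm
  have hm : min (Module.finrank k (gradedPiece (monomialCI k d) (i + 1)))
      (Module.finrank k (gradedPiece (monomialCI k d) i)) =
      min (boxLevel d (i + 1)).card (boxLevel d i).card := by
    rw [h1, h1]
  rw [hm]
  apply le_antisymm
  · rw [e1]
    exact (minorIdeal_mul_right_le k _ _ _).trans (minorIdeal_mul_left_le k _ _ _)
  · change minorIdeal _ (LinearMap.toMatrix (b i) (b (i + 1)) _) ≤ _
    rw [e2]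
    exact (minorIdeal_mul_right_le k _ _ _).trans (minorIdeal_mul_left_le k _ _ _)

end MonomialBasis

/-! ### The `sl₂`-action and injectivity of multiplication -/

section Lowering

variable {k : Type*} [Field k] {n : ℕ} {d : Fin n → ℕ}

/-- The lowering operator `∑_{j ∈ s} a_j⁻¹ ((d_j - 1) ∂_j - x_j ∂_j²)` on polynomials. If
`s` is the set of `j` with `a_j ≠ 0`, then on `k[x_1,…,x_n]/⟨x_1^{d_1},…,x_n^{d_n}⟩` it forms,
together with multiplication by `a_1 x_1 + ⋯ + a_n x_n`, a representation of `sl₂`. -/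
def lowering (d : Fin n → ℕ) (a : Fin n → k) (s : Finset (Fin n)) :
    MvPolynomial (Fin n) k →ₗ[k] MvPolynomial (Fin n) k :=
  ∑ j ∈ s, (a j)⁻¹ • (((d j : k) - 1) • (pderiv j).toLinearMap -
    LinearMap.mulLeft k (X j) ∘ₗ (pderiv j).toLinearMap ∘ₗ (pderiv j).toLinearMap)

theorem lowering_apply (a : Fin n → k) (s : Finset (Fin n)) (f : MvPolynomial (Fin n) k) :
    lowering d a s f = ∑ j ∈ s, C (a j)⁻¹ * (C ((d j : k) - 1) * pderiv j f -
      X j * pderiv j (pderiv j f)) := by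
  simp [lowering, MvPolynomial.smul_eq_C_mul]

/-- The weight that is `1` on `s` and `0` elsewhere. -/
def indicatorWeight (s : Finset (Fin n)) (j : Fin n) : ℕ := if j ∈ s then 1 else 0

theorem pderiv_eq_zero_of_weight_eq_zero {w : Fin n → ℕ} {f : MvPolynomial (Fin n) k}
    (hf : f.IsWeightedHomogeneous w 0) {j : Fin n} (hj : w j ≠ 0) : pderiv j f = 0 := by
  refine pderiv_eq_zero_of_notMem_vars fun h => ?_
  obtain ⟨v, hv, hjv⟩ := (mem_vars_iff_mem_support j).1 h
  have h1 := hf (mem_support_iff.1 hv)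
  rw [Finsupp.weight_apply, Finsupp.sum, Finset.sum_eq_zero_iff] at h1
  have h2 := h1 j hjv
  rw [smul_eq_mul, mul_eq_zero, or_iff_left hj] at h2
  exact (Finsupp.mem_support_iff.1 hjv) h2

theorem lowering_eq_zero {a : Fin n → k} {s : Finset (Fin n)} {f : MvPolynomial (Fin n) k}
    (hf : f.IsWeightedHomogeneous (indicatorWeight s) 0) : lowering d a s f = 0 := by
  rw [lowering_apply]
  refine Finset.sum_eq_zero fun j hj => ?_
  have : pderiv j f = 0 := pderiv_eq_zero_of_weight_eq_zero hf (by simp [indicatorWeight, hj])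
  simp [this]

theorem lowering_isWeightedHomogeneous {a : Fin n → k} {s : Finset (Fin n)}
    {f : MvPolynomial (Fin n) k} {m : ℕ}
    (hf : f.IsWeightedHomogeneous (indicatorWeight s) (m + 1)) :
    (lowering d a s f).IsWeightedHomogeneous (indicatorWeight s) m := by
  rw [lowering_apply]
  refine IsWeightedHomogeneous.sum _ _ _ fun j hj => ?_
  have hw : indicatorWeight s j = 1 := by simp [indicatorWeight, hj]
  have h1 : (pderiv j f).IsWeightedHomogeneous (indicatorWeight s) m := hf.pderiv (by rw [hw])
  have h2 : (X j * pderiv j (pderiv j f)).IsWeightedHomogeneous (indicatorWeight s) m := by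
    rcases Nat.eq_zero_or_pos m with rfl | hm
    · have h0 := pderiv_eq_zero_of_weight_eq_zero h1 (j := j) (by simp [hw])
      rw [h0, mul_zero]
      exact isWeightedHomogeneous_zero _ _ _
    · obtain ⟨m, rfl⟩ := Nat.exists_eq_succ_of_ne_zero hm.ne'
      have := (isWeightedHomogeneous_X k (indicatorWeight s) j).mul
        (h1.pderiv (n' := m) (by rw [hw]))
      rwa [hw, add_comm] at this
  have h3 := (isWeightedHomogeneous_C (indicatorWeight s) ((d j : k) - 1)).mul h1
  rw [zero_add] at h3
  have h4 := (isWeightedHomogeneous_C (indicatorWeight s) (a j)⁻¹).mul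
    ((weightedHomogeneousSubmodule k (indicatorWeight s) m).sub_mem h3 h2)
  rwa [zero_add] at h4

theorem lowering_mem (hd : ∀ j, 2 ≤ d j) (a : Fin n → k) (s : Finset (Fin n))
    {f : MvPolynomial (Fin n) k} (hf : f ∈ monomialCI k d) :
    lowering d a s f ∈ monomialCI k d := by
  rw [monomialCI, Ideal.mem_span_range_iff_exists_fun] at hf
  obtain ⟨c, rfl⟩ := hf
  rw [map_sum]
  refine Ideal.sum_mem _ fun l _ => ?_
  have hl : (X l : MvPolynomial (Fin n) k) ^ d l ∈ monomialCI k d := Ideal.subset_span ⟨l, rfl⟩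
  rw [lowering_apply]
  refine Ideal.sum_mem _ fun j _ => Ideal.mul_mem_left _ _ ?_
  by_cases hjl : j = l
  · subst hjl
    obtain ⟨e, he⟩ := Nat.exists_eq_add_of_le' (hd j)
    have hx : C ((d j : k) - 1) * pderiv j (c j * X j ^ d j) -
        X j * pderiv j (pderiv j (c j * X j ^ d j)) =
        (C ((d j : k) - 1) * pderiv j (c j) - 2 * C (d j : k) * pderiv j (c j) -
          X j * pderiv j (pderiv j (c j))) * X j ^ d j := by
      rw [he]
      simp only [Derivation.leibniz, Derivation.leibniz_pow, pderiv_X_self, smul_eq_mul, map_add,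
        nsmul_eq_mul, Derivation.map_natCast, map_sub, map_natCast, map_one]
      have h1 : e + 2 - 1 = e + 1 := by omega
      rw [h1]
      simp only [Nat.add_sub_cancel, Derivation.map_one_eq_zero]
      push_cast
      ring
    rw [hx]
    exact Ideal.mul_mem_left _ _ hl
  · have h0 : pderiv j (X l : MvPolynomial (Fin n) k) = 0 := pderiv_X_of_ne (Ne.symm hjl)
    have hx : C ((d j : k) - 1) * pderiv j (c l * X l ^ d l) -
        X j * pderiv j (pderiv j (c l * X l ^ d l)) =
        (C ((d j : k) - 1) * pderiv j (c l) - X j * pderiv j (pderiv j (c l))) * X l ^ d l := by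
      simp only [Derivation.leibniz, Derivation.leibniz_pow, h0, smul_eq_mul, mul_zero,
        smul_zero, zero_add]
      ring
    rw [hx]
    exact Ideal.mul_mem_left _ _ hl

/-- The commutator of multiplication by a linear form and the lowering operator is the weight. -/
theorem linearForm_mul_lowering {a : Fin n → k} {s : Finset (Fin n)} (ha : ∀ j ∈ s, a j ≠ 0)
    {f : MvPolynomial (Fin n) k} {m : ℕ}
    (hf : f.IsWeightedHomogeneous (indicatorWeight s) m) :
    linearForm a * lowering d a s f = lowering d a s (linearForm a * f) +
      C (2 * (m : k) - ∑ j ∈ s, ((d j : k) - 1)) * f := by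
  have hpd : ∀ j, pderiv j (linearForm a) = C (a j) := by
    intro j
    rw [linearForm, map_sum, Finset.sum_eq_single j]
    · simp [Derivation.leibniz]
    · intro l _ hl
      simp [Derivation.leibniz, pderiv_X_of_ne hl]
    · simp
  have heuler : (∑ j ∈ s, X j * pderiv j f) = C (m : k) * f := by
    have := hf.sum_weight_X_mul_pderiv
    simp only [indicatorWeight, ite_smul, one_smul, zero_smul, Finset.sum_ite_mem,
      Finset.univ_inter] at this
    rw [this, nsmul_eq_mul, map_natCast]
  have hterm : ∀ j ∈ s, C (a j)⁻¹ * (C ((d j : k) - 1) * pderiv j (linearForm a * f) -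
      X j * pderiv j (pderiv j (linearForm a * f))) =
      linearForm a * (C (a j)⁻¹ * (C ((d j : k) - 1) * pderiv j f -
        X j * pderiv j (pderiv j f))) + (C ((d j : k) - 1) * f - 2 * (X j * pderiv j f)) := by
    intro j hj
    have hinv : (C (a j)⁻¹ * C (a j) : MvPolynomial (Fin n) k) = 1 := by
      rw [← C_mul, inv_mul_cancel₀ (ha j hj), C_1]
    simp only [Derivation.leibniz, hpd, smul_eq_mul, map_add, pderiv_C, mul_zero]
    linear_combination (C ((d j : k) - 1) * f - 2 * (X j * pderiv j f)) * hinv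
  rw [lowering_apply, lowering_apply, Finset.sum_congr rfl hterm, Finset.sum_add_distrib,
    Finset.sum_sub_distrib, ← Finset.mul_sum, ← Finset.mul_sum, ← Finset.sum_mul, heuler,
    ← map_sum]
  simp only [map_sub, map_mul, map_ofNat]
  ring

/-- Multiplication by a linear form is injective, modulo the monomial complete intersection, on
forms of negative weight: applying powers of the lowering operator to an element of the kernel
gives a string that ends in `0` and whose terms are recovered, up to nonzero scalars, from their
successors. -/
theorem mem_of_linearForm_mul_mem [CharZero k] (hd : ∀ j, 2 ≤ d j) {a : Fin n → k}
    {s : Finset (Fin n)} (ha : ∀ j ∈ s, a j ≠ 0) {f : MvPolynomial (Fin n) k} {m : ℕ}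
    (hm : 2 * m < ∑ j ∈ s, (d j - 1))
    (hf : f.IsWeightedHomogeneous (indicatorWeight s) m)
    (hlf : linearForm a * f ∈ monomialCI k d) : f ∈ monomialCI k d := by
  have he : ∑ j ∈ s, ((d j : k) - 1) = ((∑ j ∈ s, (d j - 1) : ℕ) : k) := by
    rw [Nat.cast_sum]
    refine Finset.sum_congr rfl fun j _ => ?_
    rw [Nat.cast_sub (by have := hd j; omega), Nat.cast_one]
  generalize he' : ∑ j ∈ s, (d j - 1) = e at hm he
  have hwt : ∀ r ≤ m,
      ((lowering d a s ^ r) f).IsWeightedHomogeneous (indicatorWeight s) (m - r) := by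
    intro r
    induction r with
    | zero => intro _; simpa using hf
    | succ r ih =>
      intro hr
      rw [pow_succ', Module.End.mul_apply]
      refine lowering_isWeightedHomogeneous ?_
      have := ih (by omega)
      rwa [show m - r = m - (r + 1) + 1 by omega] at this
  -- the constants `(r + 1) (2 m - e - r)` are those of a lowest weight vector of weight `2 m - e`,
  -- nonzero because that weight is negative
  have hstring : ∀ r ≤ m, linearForm a * (lowering d a s ^ (r + 1)) f -
      C (((r : k) + 1) * (2 * m - e - r)) * (lowering d a s ^ r) f ∈ monomialCI k d := by
    intro r
    induction r with
    | zero =>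
      intro _
      rw [zero_add, pow_one, pow_zero, linearForm_mul_lowering ha hf, he]
      simpa using lowering_mem hd a s hlf
    | succ r ih =>
      intro hr
      have h1 := lowering_mem hd a s (ih (by omega))
      rw [pow_succ' _ (r + 1), Module.End.mul_apply, linearForm_mul_lowering ha (hwt _ hr), he]
      rw [map_sub, ← MvPolynomial.smul_eq_C_mul, map_smul, ← Module.End.mul_apply (lowering d a s),
        ← pow_succ', MvPolynomial.smul_eq_C_mul] at h1
      convert h1 using 1
      rw [Nat.cast_sub hr, add_sub_assoc, ← sub_mul, ← C_sub, sub_eq_add_neg _ (C _ * _),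
        ← neg_mul, ← C_neg]
      congr 3
      push_cast
      ring
  have hdesc : ∀ t ≤ m + 1, (lowering d a s ^ (m + 1 - t)) f ∈ monomialCI k d := by
    intro t
    induction t with
    | zero =>
      intro _
      rw [Nat.sub_zero, pow_succ', Module.End.mul_apply, lowering_eq_zero]
      · exact zero_mem _
      · simpa using hwt m le_rfl
    | succ t ih =>
      intro ht
      have h1 := ih (by omega)
      obtain ⟨r, hr⟩ : ∃ r, r = m + 1 - (t + 1) := ⟨_, rfl⟩
      rw [show m + 1 - t = r + 1 by omega] at h1
      rw [← hr]
      have h2 := hstring r (by omega)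
      have h3 := (monomialCI k d).sub_mem ((monomialCI k d).mul_mem_left (linearForm a) h1) h2
      rw [sub_sub_cancel] at h3
      have hc : ((r : k) + 1) * (2 * m - e - r) ≠ 0 := by
        refine mul_ne_zero (Nat.cast_add_one_ne_zero r) ?_
        have : ((e + r : ℕ) : k) ≠ ((2 * m : ℕ) : k) := by
          rw [Ne, Nat.cast_inj]
          omega
        intro h0
        apply this
        push_cast
        linear_combination -h0
      exact (Ideal.unit_mul_mem_iff_mem _ ((IsUnit.mk0 _ hc).map C)).1 h3
  simpa using hdesc (m + 1) le_rfl

/-- The matrix of multiplication by a linear form is injective on the vectors that involve only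
monomials of a fixed negative weight. -/
theorem eq_zero_of_stepMatrix_mulVec [CharZero k] (hd : ∀ j, 2 ≤ d j) {a : Fin n → k}
    {s : Finset (Fin n)} (ha : ∀ j ∈ s, a j ≠ 0) {i m : ℕ} (hm : 2 * m < ∑ j ∈ s, (d j - 1))
    {c : boxLevel d i → k} (hc : ∀ v, c v ≠ 0 → ∑ j ∈ s, v.1 j = m)
    (h : (stepMatrix d a i).mulVec c = 0) : c = 0 := by
  set f : MvPolynomial (Fin n) k := ∑ v, monomial v.1 (c v) with hfdef
  have hfw : f.IsWeightedHomogeneous (indicatorWeight s) m := by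
    refine IsWeightedHomogeneous.sum _ _ _ fun v _ => ?_
    by_cases hv : c v = 0
    · rw [hv, map_zero]
      exact isWeightedHomogeneous_zero _ _ _
    · refine isWeightedHomogeneous_monomial _ _ _ ?_
      rw [← hc v hv, Finsupp.weight_apply, Finsupp.sum_fintype _ _ (by simp)]
      simp [indicatorWeight]
  have hfmk : Ideal.Quotient.mk (monomialCI k d) f =
      ((boxBasis k d i).equivFun.symm c : gradedPiece (monomialCI k d) i) := by
    rw [Module.Basis.equivFun_symm_apply, Submodule.coe_sum, hfdef, map_sum]
    refine Finset.sum_congr rfl fun v _ => ?_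
    have hm : (monomial v.1 (c v) : MvPolynomial (Fin n) k) = c v • monomial v.1 1 := by
      simp [smul_monomial]
    rw [hm, boxBasis, Module.Basis.mk_apply]
    rfl
  have hlf : linearForm a * f ∈ monomialCI k d := by
    rw [← Ideal.Quotient.eq_zero_iff_mem, map_mul, hfmk]
    have h1 : mulMap (monomialCI k d) (linearForm a) (linearForm_isHomogeneous a) i
        ((boxBasis k d i).equivFun.symm c) = 0 := by
      rw [mulMap_eq_toLin _ rfl, Matrix.toLin_apply]
      simp only [← Module.Basis.equivFun_apply, LinearEquiv.apply_symm_apply, h]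
      simp
    exact congrArg Subtype.val h1
  have hf := mem_of_linearForm_mul_mem hd ha hm hfw hlf
  rw [← Ideal.Quotient.eq_zero_iff_mem, hfmk] at hf
  exact (LinearEquiv.map_eq_zero_iff _).1 (Subtype.ext hf)

theorem stepMatrix_mulVec_injective [CharZero k] (hd : ∀ j, 2 ≤ d j) {a : Fin n → k}
    (ha : ∀ j, a j ≠ 0) {i : ℕ} (hi : 2 * i < ∑ j, (d j - 1)) :
    Function.Injective (stepMatrix d a i).mulVec := by
  refine (injective_iff_map_eq_zero (stepMatrix d a i).mulVecLin).2 fun c hc => ?_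
  exact eq_zero_of_stepMatrix_mulVec hd (s := Finset.univ) (fun j _ => ha j) hi
    (fun v _ => (mem_boxLevel.1 v.2).1) hc

end Lowering

/-! ### Counting monomials in a box -/

section Counting

variable {n : ℕ} {d : Fin n → ℕ}

/-- The Hilbert series `∏_{j ∈ s} (1 + X + ⋯ + X^{d_j - 1})` of the monomial complete intersection
in the variables of `s`. -/
def boxSeries (d : Fin n → ℕ) (s : Finset (Fin n)) : Polynomial ℤ :=
  ∏ j ∈ s, ∑ b ∈ Finset.range (d j), Polynomial.X ^ b

theorem card_filter_boxLevel (t : Fin n → Finset ℕ) (ht : ∀ j, t j ⊆ Finset.range (d j)) (i : ℕ) :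
    (((boxLevel d i).filter fun v => ∀ j, v j ∈ t j).card : ℤ) =
      (∏ j, ∑ b ∈ t j, (Polynomial.X : Polynomial ℤ) ^ b).coeff i := by
  rw [Finset.prod_univ_sum, Polynomial.finsetSum_coeff]
  simp only [Finset.prod_pow_eq_pow_sum, Polynomial.coeff_X_pow]
  rw [Finset.sum_boole]
  congr 1
  refine Finset.card_bij (fun v _ j => v j) ?_ ?_ ?_
  · intro v hv
    rw [Finset.mem_filter, mem_boxLevel] at hv
    simp [Fintype.mem_piFinset, hv.2, hv.1.1]
  · intro v _ w _ h
    exact Finsupp.ext (congrFun h)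
  · intro x hx
    rw [Finset.mem_filter, Fintype.mem_piFinset] at hx
    refine ⟨Finsupp.equivFunOnFinite.symm x, ?_, by ext; simp⟩
    rw [Finset.mem_filter, mem_boxLevel]
    refine ⟨⟨?_, fun j => ?_⟩, hx.1⟩
    · simpa using hx.2.symm
    · simpa using ht j (hx.1 j)

/-- The coefficients of a polynomial, extended by `0` to negative indices. -/
def intCoeff (p : Polynomial ℤ) (m : ℤ) : ℤ := if 0 ≤ m then p.coeff m.toNat else 0

@[simp]
theorem intCoeff_natCast (p : Polynomial ℤ) (i : ℕ) : intCoeff p i = p.coeff i := by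
  simp [intCoeff]

theorem intCoeff_X_pow_mul (p : Polynomial ℤ) (b : ℕ) (m : ℤ) :
    intCoeff (Polynomial.X ^ b * p) m = intCoeff p (m - b) := by
  unfold intCoeff
  by_cases h : 0 ≤ m
  · rw [if_pos h, Polynomial.coeff_X_pow_mul']
    by_cases hb : (b : ℤ) ≤ m
    · rw [if_pos (by omega), if_pos (by omega)]
      congr 1
      omega
    · rw [if_neg (by omega), if_neg (by omega)]
  · rw [if_neg h, if_neg (by omega)]

theorem intCoeff_sum_mul (p : Polynomial ℤ) (c : ℕ) (m : ℤ) :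
    intCoeff ((∑ b ∈ Finset.range c, Polynomial.X ^ b) * p) m =
      ∑ b ∈ Finset.range c, intCoeff p (m - b) := by
  simp only [← intCoeff_X_pow_mul, Finset.sum_mul]
  unfold intCoeff
  split_ifs with h
  · rw [Polynomial.finsetSum_coeff]
  · simp

/-- The number of monomials of degree `i` in the box whose `j`-th exponent is `b`. -/
theorem card_filter_coord_eq (j : Fin n) {b : ℕ} (hb : b < d j) (i : ℕ) :
    (((boxLevel d i).filter fun v => v j = b).card : ℤ) =
      intCoeff (boxSeries d (Finset.univ.erase j)) (i - b) := by
  have h := card_filter_boxLevel (d := d)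
    (fun l => if l = j then {b} else Finset.range (d l)) (fun l => by
      split_ifs with h
      · subst h; simpa using hb
      · rfl) i
  rw [← intCoeff_X_pow_mul, intCoeff_natCast]
  rw [← Finset.mul_prod_erase _ _ (Finset.mem_univ j)] at h
  rw [if_pos rfl, Finset.sum_singleton] at h
  convert h using 2
  · congr 1
    ext v
    rw [Finset.mem_filter, Finset.mem_filter]
    refine and_congr_right fun hv => ⟨fun h l => ?_, fun h => by simpa using h j⟩
    split_ifs with hl
    · subst hl; simpa using h
    · simpa using (mem_boxLevel.1 hv).2 l
  · congr 1
    refine Finset.prod_congr rfl fun l hl => ?_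
    rw [if_neg (Finset.ne_of_mem_erase hl)]

theorem card_filter_coord_eq_coord_eq {j j' : Fin n} (hj : j ≠ j') {b b' : ℕ} (hb : b < d j)
    (hb' : b' < d j') (i : ℕ) :
    (((boxLevel d i).filter fun v => v j = b ∧ v j' = b').card : ℤ) =
      intCoeff (boxSeries d ((Finset.univ.erase j).erase j')) (i - b - b') := by
  have h := card_filter_boxLevel (d := d)
    (fun l => if l = j then {b} else if l = j' then {b'} else Finset.range (d l)) (fun l => by
      split_ifs with h h'
      · subst h; simpa using hb
      · subst h'; simpa using hb'
      · rfl) i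
  rw [← intCoeff_X_pow_mul, ← intCoeff_X_pow_mul, intCoeff_natCast]
  rw [← Finset.mul_prod_erase _ _ (Finset.mem_univ j), ← Finset.mul_prod_erase (Finset.univ.erase j)
    _ (Finset.mem_erase.2 ⟨hj.symm, Finset.mem_univ j'⟩)] at h
  rw [if_pos rfl, if_neg hj.symm, if_pos rfl, Finset.sum_singleton, Finset.sum_singleton] at h
  convert h using 2
  · congr 1
    ext v
    rw [Finset.mem_filter, Finset.mem_filter]
    refine and_congr_right fun hv => ⟨fun h l => ?_, fun h => ⟨by simpa using h j, ?_⟩⟩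
    · split_ifs with hl hl'
      · subst hl; simpa using h.1
      · subst hl'; simpa using h.2
      · simpa using (mem_boxLevel.1 hv).2 l
    · simpa [hj.symm] using h j'
  · congr 2
    refine Finset.prod_congr rfl fun l hl => ?_
    rw [if_neg (Finset.ne_of_mem_erase (Finset.mem_of_mem_erase hl)),
      if_neg (Finset.ne_of_mem_erase hl)]

theorem card_boxLevel (i : ℕ) :
    ((boxLevel d i).card : ℤ) = intCoeff (boxSeries d Finset.univ) i := by
  have h := card_filter_boxLevel (d := d) (fun l => Finset.range (d l)) (fun l => subset_rfl) i
  rw [intCoeff_natCast, boxSeries, ← h, Finset.filter_true_of_mem]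
  intro v hv j
  simpa using (mem_boxLevel.1 hv).2 j

/-- The shape of the Hilbert function `h` of a monomial complete intersection with socle degree
`e` and all exponents at most `D`: it is positive exactly in the range `0, …, e` (and zero
below), symmetric, unimodal, and strictly increasing before the middle outside a possible plateau,
which cannot start before degree `e - (D - 1)`. -/
structure IsBoxShape (e D : ℤ) (h : ℤ → ℤ) : Prop where
  eq_zero : ∀ m < 0, h m = 0
  pos : ∀ m, 0 ≤ m → m ≤ e → 0 < h m
  symm : ∀ m, h (e - m) = h m
  mono : ∀ x y, x ≤ y → x + y ≤ e → h x ≤ h y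
  strict : ∀ m, -1 ≤ m → 2 * m + 1 < e → m + 1 ≤ e - (D - 1) → h m < h (m + 1)

theorem IsBoxShape.nonneg {e D : ℤ} {h : ℤ → ℤ} (H : IsBoxShape e D h) (m : ℤ) : 0 ≤ h m := by
  rcases lt_or_ge m 0 with h0 | h0
  · exact (H.eq_zero m h0).ge
  · rcases le_or_gt m e with h1 | h1
    · exact (H.pos m h0 h1).le
    · rw [← H.symm]
      exact (H.eq_zero _ (by omega)).ge

theorem IsBoxShape.weaken {e D D' : ℤ} {h : ℤ → ℤ} (H : IsBoxShape e D h) (hD : D ≤ D') :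
    IsBoxShape e D' h :=
  { H with strict := fun m h1 h2 h3 => H.strict m h1 h2 (by omega) }

theorem le_of_symm_of_step {e : ℤ} {h : ℤ → ℤ} (hs : ∀ m, h (e - m) = h m)
    (hstep : ∀ m, 2 * m < e → h m ≤ h (m + 1)) (x y : ℤ) (hxy : x ≤ y) (hsum : x + y ≤ e) :
    h x ≤ h y := by
  have key : ∀ y, x ≤ y → 2 * y ≤ e + 1 → h x ≤ h y := by
    intro y hy
    induction y, hy using Int.leInduction with
    | base => intro _; exact le_rfl
    | succ y hy ih =>
      intro h2
      exact (ih (by omega)).trans (hstep y (by omega))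
  rcases le_or_gt (2 * y) (e + 1) with h1 | h1
  · exact key y hxy h1
  · rw [← hs y]
    exact key _ (by omega) (by omega)

/-- Adding a variable whose exponent is at least all the others. -/
theorem IsBoxShape.convolve {e D : ℤ} {h : ℤ → ℤ} (H : IsBoxShape e D h) {c : ℕ} (hD : D ≤ c)
    (he : 0 ≤ e) (hc : 2 ≤ c) :
    IsBoxShape (e + (c - 1)) c fun m => ∑ b ∈ Finset.range c, h (m - b) := by
  have htel : ∀ m : ℤ, ∑ b ∈ Finset.range c, h (m + 1 - b) + h (m + 1 - c) =
      ∑ b ∈ Finset.range c, h (m - b) + h (m + 1) := by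
    intro m
    rw [← Finset.sum_range_succ fun b : ℕ => h (m + 1 - b), Finset.sum_range_succ']
    congr 1
    · refine Finset.sum_congr rfl fun b _ => ?_
      congr 1
      push_cast
      ring
    · simp
  have hsymm : ∀ m : ℤ, ∑ b ∈ Finset.range c, h (e + (c - 1) - m - b) =
      ∑ b ∈ Finset.range c, h (m - b) := by
    intro m
    rw [← Finset.sum_range_reflect]
    refine Finset.sum_congr rfl fun b hb => ?_
    have hb' := Finset.mem_range.1 hb
    rw [← H.symm]
    congr 1
    omega
  refine ⟨fun m hm => ?_, fun m h0 h1 => ?_, hsymm, le_of_symm_of_step hsymm fun m hm => ?_,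
    fun m h1 h2 h3 => ?_⟩
  · exact Finset.sum_eq_zero fun b _ => H.eq_zero _ (by omega)
  · refine Finset.sum_pos' (fun b _ => H.nonneg _) ⟨min m.toNat (c - 1), ?_, ?_⟩
    · rw [Finset.mem_range]
      omega
    · exact H.pos _ (by omega) (by omega)
  · have h4 := htel m
    have h5 := H.mono (m + 1 - c) (m + 1) (by omega) (by omega)
    linarith
  · have h4 := htel m
    suffices h (m + 1 - c) < h (m + 1) by linarith
    rcases lt_or_ge (m + 1 - c) 0 with h5 | h5
    · rw [H.eq_zero _ h5]
      exact H.pos _ (by omega) (by omega)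
    · exact (H.strict _ (by omega) (by omega) (by omega)).trans_le
        (H.mono _ _ (by omega) (by omega))

theorem isBoxShape_boxSeries (hd : ∀ j, 2 ≤ d j) (s : Finset (Fin n)) :
    ∀ D : ℕ, (∀ j ∈ s, d j ≤ D) →
      IsBoxShape (∑ j ∈ s, ((d j : ℤ) - 1)) D (intCoeff (boxSeries d s)) := by
  induction s using Finset.induction_on_max_value d with
  | empty =>
    intro D _
    have h : ∀ m, intCoeff (boxSeries d ∅) m = if m = 0 then 1 else 0 := by
      intro m
      simp only [intCoeff, boxSeries, Finset.prod_empty, Polynomial.coeff_one]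
      split_ifs <;> first | rfl | omega
    constructor <;> simp only [h, Finset.sum_empty] <;> intros <;> split_ifs <;> omega
  | insert a s ha hmax ih =>
    intro D hD
    have h1 := (ih (d a) hmax).convolve (c := d a) le_rfl
      (Finset.sum_nonneg fun j _ => by have := hd j; omega) (hd a)
    have h2 := h1.weaken (Nat.cast_le.2 (hD a (Finset.mem_insert_self a s)))
    convert h2 using 1
    · rw [Finset.sum_insert ha, add_comm]
    · ext m
      rw [boxSeries, Finset.prod_insert ha, intCoeff_sum_mul]
      rfl

theorem card_boxLevel_mono (hd : ∀ j, 2 ≤ d j) {i i' : ℕ} (h : i ≤ i')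
    (h' : i + i' ≤ ∑ j, (d j - 1)) : (boxLevel d i).card ≤ (boxLevel d i').card := by
  have H := isBoxShape_boxSeries hd Finset.univ (Finset.univ.sup d)
    fun j _ => Finset.le_sup (Finset.mem_univ j)
  have hs : ∑ j, ((d j : ℤ) - 1) = ((∑ j, (d j - 1) : ℕ) : ℤ) := by
    rw [Nat.cast_sum]
    refine Finset.sum_congr rfl fun j _ => ?_
    have := hd j
    omega
  have := H.mono i i' (by omega) (by rw [hs]; exact_mod_cast h')
  rw [← card_boxLevel, ← card_boxLevel] at this
  exact_mod_cast this

/-- Outside the two exceptional cases there are a variable `x_j` and a degree `i` such that the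
Hilbert function `h` of the complete intersection in the remaining variables decreases from
degree `i` to `i + 1` but increases from degree `i - b` to `i + 1 - b` for some `b < d_j`. The
variable is one with the largest exponent. -/
theorem exists_descent_and_ascent (hn : 1 ≤ n) (hd : ∀ j, 2 ≤ d j)
    (h1 : ¬ ((∀ j, d j = 2) ∧ Even n)) (h2 : ¬ (n = 2 ∧ ∀ j j', d j = d j')) :
    ∃ (j : Fin n) (i b : ℕ), b < d j ∧
      intCoeff (boxSeries d (Finset.univ.erase j)) ((i + 1 : ℕ) : ℤ) <
        intCoeff (boxSeries d (Finset.univ.erase j)) i ∧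
      intCoeff (boxSeries d (Finset.univ.erase j)) (i - b) <
        intCoeff (boxSeries d (Finset.univ.erase j)) ((i + 1 : ℕ) - b) := by
  have : Nonempty (Fin n) := ⟨⟨0, hn⟩⟩
  obtain ⟨j, -, hj⟩ := Finset.exists_max_image Finset.univ d Finset.univ_nonempty
  set s := Finset.univ.erase j with hs
  -- the largest exponent of the other variables, or `1` if there are none
  obtain ⟨D, hD1, hDs, hDe, hDj⟩ : ∃ D : ℕ, 1 ≤ D ∧ (∀ l ∈ s, d l ≤ D) ∧
      (D : ℤ) - 1 ≤ ∑ l ∈ s, ((d l : ℤ) - 1) ∧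
      2 * (D : ℤ) - d j ≤ ∑ l ∈ s, ((d l : ℤ) - 1) := by
    rcases s.eq_empty_or_nonempty with h0 | hne
    · refine ⟨1, le_rfl, by simp [h0], by simp [h0], ?_⟩
      have := hd j
      simp only [h0, Finset.sum_empty]
      omega
    · obtain ⟨l, hl, hmax⟩ := Finset.exists_max_image s d hne
      have hle : (d l : ℤ) - 1 + ∑ m ∈ s.erase l, ((d m : ℤ) - 1) =
        ∑ m ∈ s, ((d m : ℤ) - 1) := Finset.add_sum_erase s (fun m => (d m : ℤ) - 1) hl
      have hnn : ∀ m ∈ s.erase l, (1 : ℤ) ≤ (d m : ℤ) - 1 := fun m _ => by have := hd m; omega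
      have hge := Finset.card_nsmul_le_sum _ _ _ hnn
      rw [Finset.card_erase_of_mem hl, hs, Finset.card_erase_of_mem (Finset.mem_univ j),
        Finset.card_univ, Fintype.card_fin, ← hs, nsmul_eq_mul, mul_one] at hge
      have hlj := hj l (Finset.mem_univ l)
      have hdl := hd l
      refine ⟨d l, by omega, hmax, by omega, ?_⟩
      rcases Nat.lt_or_ge 2 n with h3 | h3
      · omega
      · have hn2 : n = 2 := by
          have := (Finset.ne_of_mem_erase hl)
          have h4 : Fintype.card (Fin n) ≠ 1 := fun h =>
            this ((Fintype.card_eq_one_iff_nonempty_unique.1 h).elim fun _ => Subsingleton.elim _ _)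
          rw [Fintype.card_fin] at h4
          omega
        have hlt : d l < d j := by
          refine lt_of_le_of_ne hlj fun heq => h2 ⟨hn2, ?_⟩
          have hall : ∀ m, d m = d j := by
            intro m
            by_cases hm : m = j
            · rw [hm]
            · by_cases hm' : m = l
              · rw [hm', heq]
              · have hc : ({m, j, l} : Finset (Fin n)).card = 3 :=
                  Finset.card_eq_three.2 ⟨m, j, l, hm, hm', (Finset.ne_of_mem_erase hl).symm, rfl⟩
                have := Finset.card_le_univ ({m, j, l} : Finset (Fin n))
                rw [Fintype.card_fin] at this
                omega
          intro m m'
          rw [hall m, hall m']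
        omega
  have H := isBoxShape_boxSeries hd s D hDs
  have hpar : d j = 2 → Even (∑ l ∈ s, ((d l : ℤ) - 1)) := by
    intro h
    have hall : ∀ l, d l = 2 := fun l => le_antisymm (h ▸ hj l (Finset.mem_univ l)) (hd l)
    have hodd : ¬ Even n := fun he => h1 ⟨hall, he⟩
    rw [Nat.not_even_iff_odd] at hodd
    have : ∑ l ∈ s, ((d l : ℤ) - 1) = ((n - 1 : ℕ) : ℤ) := by
      simp only [hall]
      rw [Finset.sum_const, hs, Finset.card_erase_of_mem (Finset.mem_univ j), Finset.card_univ,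
        Fintype.card_fin]
      simp
    rw [this, Int.even_coe_nat]
    exact Nat.Odd.sub_odd hodd odd_one
  generalize ∑ l ∈ s, ((d l : ℤ) - 1) = e at *
  -- the last degree before the plateau of maximal values of `h`
  set m : ℤ := min (e / 2) (e - D + 1) - 1 with hm
  have hdj := hd j
  have hm1 : -1 ≤ m := by omega
  -- by symmetry `h` drops after `e - 1 - m`, and this says that the shift `b = e - 1 - 2 m` is
  -- smaller than `d_j`
  have hlow : e - d j ≤ 2 * m := by
    rcases Nat.lt_or_ge 2 (d j) with h | h
    · omega
    · obtain ⟨x, hx⟩ := hpar (by omega)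
      omega
  have hst := H.strict m hm1 (by omega) (by omega)
  refine ⟨j, (e - 1 - m).toNat, (e - 1 - 2 * m).toNat, by omega, ?_, ?_⟩
  · rw [← H.symm, ← H.symm ((e - 1 - m).toNat : ℤ)]
    convert hst using 2 <;> omega
  · convert hst using 2 <;> omega

end Counting

section LinearAlgebra

variable {k : Type*} [Field k] {ι κ : Type*} [Fintype ι] [Fintype κ]

theorem not_injective_mulVec_of_card_lt {M : Matrix ι κ k} {S : Finset κ} {T : Finset ι}
    (h : ∀ u, ∀ v ∈ S, M u v ≠ 0 → u ∈ T) (hcard : T.card < S.card) :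
    ¬ Function.Injective M.mulVec := by
  classical
  intro hinj
  have hker : LinearMap.ker (M.submatrix ((↑) : T → ι) ((↑) : S → κ)).mulVecLin ≠ ⊥ :=
    LinearMap.ker_ne_bot_of_finrank_lt (by simpa using hcard)
  obtain ⟨x, hx, hx0⟩ := Submodule.exists_mem_ne_zero_of_ne_bot hker
  let c : κ → k := fun v => if h : v ∈ S then x ⟨v, h⟩ else 0
  have hc : M.mulVec c = 0 := by
    ext u
    have hsum : M.mulVec c u = ∑ v : S, M u v * x v := by
      rw [Matrix.mulVec, dotProduct, ← Finset.sum_subset (Finset.subset_univ S),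
        ← Finset.sum_coe_sort S]
      · refine Finset.sum_congr rfl fun v _ => ?_
        simp [c]
      · intro v _ hv
        simp [c, hv]
    rw [hsum]
    by_cases hu : u ∈ T
    · exact congrFun hx ⟨u, hu⟩
    · refine Finset.sum_eq_zero fun v _ => ?_
      have : M u v = 0 := by
        by_contra h0
        exact hu (h u v v.2 h0)
      rw [this, zero_mul]
  have hc0 : c = 0 := hinj (by rw [hc, Matrix.mulVec_zero])
  apply hx0
  ext v
  have := congrFun hc0 v
  simpa [c] using this

theorem mulVec_surjective_iff_transpose_injective {M : Matrix ι κ k} :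
    Function.Surjective M.mulVec ↔ Function.Injective M.transpose.mulVec := by
  classical
  rw [Matrix.mulVec_surjective_iff_exists_right_inverse]
  constructor
  · rintro ⟨N, hN⟩
    have h : N.transpose * M.transpose = 1 := by
      rw [← Matrix.transpose_mul, hN, Matrix.transpose_one]
    intro x y hxy
    have := congrArg N.transpose.mulVec hxy
    simpa [h] using this
  · intro h
    obtain ⟨g, hg⟩ := LinearMap.exists_leftInverse_of_injective M.transpose.mulVecLin
      (LinearMap.ker_eq_bot.2 h)
    refine ⟨(LinearMap.toMatrix' g).transpose, ?_⟩
    have h1 := congrArg LinearMap.toMatrix' hg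
    rw [LinearMap.toMatrix'_comp, ← Matrix.toLin'_apply', LinearMap.toMatrix'_toLin',
      LinearMap.toMatrix'_id] at h1
    rw [← Matrix.transpose_transpose M, ← Matrix.transpose_mul, h1, Matrix.transpose_one]

theorem not_surjective_mulVec_of_card_lt {M : Matrix ι κ k} {S : Finset κ} {T : Finset ι}
    (h : ∀ u ∈ T, ∀ v, M u v ≠ 0 → v ∈ S) (hcard : S.card < T.card) :
    ¬ Function.Surjective M.mulVec := by
  rw [mulVec_surjective_iff_transpose_injective]
  exact not_injective_mulVec_of_card_lt (fun v u hu hne => h u hu v hne) hcard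

end LinearAlgebra

/-! ### Lefschetz elements and the codimension of the non-Lefschetz locus -/

section Locus

variable {k : Type*} [Field k] {n : ℕ} {d : Fin n → ℕ}

theorem isLefschetzElement_iff (a : Fin n → k) :
    IsLefschetzElement (monomialCI k d) (linearForm a) (linearForm_isHomogeneous a) ↔
      ∀ i, Function.Injective (stepMatrix d a i).mulVec ∨
        Function.Surjective (stepMatrix d a i).mulVec :=
  forall_congr' fun i => or_congr (mulMap_injective_iff a i) (mulMap_surjective_iff a i)

theorem boxLevel_eq_empty {i : ℕ} (hi : ∑ j, (d j - 1) < i) : boxLevel d i = ∅ := by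
  refine Finset.eq_empty_of_forall_notMem fun v hv => ?_
  obtain ⟨h1, h2⟩ := mem_boxLevel.1 hv
  have : ∑ j, v j ≤ ∑ j, (d j - 1) := Finset.sum_le_sum fun j _ => by have := h2 j; omega
  omega

/-- By duality, injectivity below the middle degree suffices for a Lefschetz element. -/
theorem isLefschetzElement_of_injective {a : Fin n → k}
    (h : ∀ i, 2 * i < ∑ j, (d j - 1) → Function.Injective (stepMatrix d a i).mulVec) :
    IsLefschetzElement (monomialCI k d) (linearForm a) (linearForm_isHomogeneous a) := by
  rw [isLefschetzElement_iff]
  intro i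
  rcases lt_or_ge (2 * i) (∑ j, (d j - 1)) with hi | hi
  · exact Or.inl (h i hi)
  · right
    rcases le_or_gt (i + 1) (∑ j, (d j - 1)) with hi' | hi'
    · obtain ⟨i', he⟩ := Nat.exists_eq_add_of_le hi'
      rw [mulVec_surjective_iff_transpose_injective,
        stepMatrix_transpose a (i' := i') (by omega) (by omega)]
      refine (injective_iff_map_eq_zero (Matrix.mulVecLin _)).2 fun c hc => ?_
      rw [Matrix.mulVecLin_apply, Matrix.submatrix_mulVec_equiv] at hc
      have h1 := h i' (by omega)
      have h2 : (stepMatrix d a i').mulVec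
          (c ∘ (complementEquiv (d := d) (i := i + 1) (i' := i') (by omega)).symm) = 0 := by
        ext u
        obtain ⟨u', rfl⟩ :=
          (complementEquiv (d := d) (i := i) (i' := i' + 1) (by omega)).surjective u
        exact congrFun hc u'
      have h3 := h1 (h2.trans (Matrix.mulVec_zero _).symm)
      ext v
      have h4 := congrFun h3 (complementEquiv (d := d) (i := i + 1) (i' := i') (by omega) v)
      simpa using h4
    · have : IsEmpty (boxLevel d (i + 1)) := by
        rw [boxLevel_eq_empty hi']
        infer_instance
      exact fun y => ⟨0, Subsingleton.elim _ _⟩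

theorem isLefschetzElement_of_forall_ne_zero [CharZero k] (hd : ∀ j, 2 ≤ d j) {a : Fin n → k}
    (ha : ∀ j, a j ≠ 0) :
    IsLefschetzElement (monomialCI k d) (linearForm a) (linearForm_isHomogeneous a) :=
  isLefschetzElement_of_injective fun _ hi => stepMatrix_mulVec_injective hd ha hi

/-- For squares of an even number of variables, a linear form with at most one vanishing coefficient
is still a Lefschetz element: the two summands of the algebra cut out by the exponent of the missing
variable both have negative weight in the lower half. -/
theorem isLefschetzElement_of_squares [CharZero k] (hd : ∀ j, d j = 2) (hn : Even n)
    {a : Fin n → k} {m : Fin n} (ha : ∀ j, j ≠ m → a j ≠ 0) :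
    IsLefschetzElement (monomialCI k d) (linearForm a) (linearForm_isHomogeneous a) := by
  have hd' : ∀ j, 2 ≤ d j := fun j => (hd j).ge
  by_cases ham : a m = 0
  swap
  · refine isLefschetzElement_of_forall_ne_zero hd' fun j => ?_
    by_cases hj : j = m
    · rwa [hj]
    · exact ha j hj
  refine isLefschetzElement_of_injective fun i hi => ?_
  simp only [hd] at hi
  refine (injective_iff_map_eq_zero (stepMatrix d a i).mulVecLin).2 fun c hc => ?_
  -- the exponent of `x_m` is preserved, so each of its values gives a kernel vector of its own
  have hpart : ∀ b, (fun v : boxLevel d i => if v.1 m = b then c v else 0) = 0 := by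
    intro b
    refine eq_zero_of_stepMatrix_mulVec hd' (s := Finset.univ.erase m) (m := i - b)
      (fun j hj => ha j (Finset.ne_of_mem_erase hj)) ?_ ?_ ?_
    · simp only [hd, Finset.sum_const, Finset.card_erase_of_mem (Finset.mem_univ m),
        Finset.card_univ, Fintype.card_fin, smul_eq_mul] at hi ⊢
      obtain ⟨r, hr⟩ := hn
      omega
    · intro v hv
      have hvb : v.1 m = b := by
        by_contra h
        simp [h] at hv
      have h1 := (mem_boxLevel.1 v.2).1
      rw [← Finset.add_sum_erase _ _ (Finset.mem_univ m), hvb] at h1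
      omega
    · ext u
      have h1 : (stepMatrix d a i).mulVec (fun v => if v.1 m = b then c v else 0) u =
          if u.1 m = b then (stepMatrix d a i).mulVec c u else 0 := by
        have h2 : (if u.1 m = b then (stepMatrix d a i).mulVec c u else 0) =
            ∑ v, if u.1 m = b then stepMatrix d a i u v * c v else 0 := by
          split_ifs
          · rfl
          · simp
        rw [h2, Matrix.mulVec, dotProduct]
        refine Finset.sum_congr rfl fun v _ => ?_
        by_cases h0 : stepMatrix d a i u v = 0
        · simp [h0]
        · obtain ⟨l, hl, hal⟩ := stepMatrix_ne_zero h0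
          have hlm : l ≠ m := by
            rintro rfl
            exact hal ham
          have huv : u.1 m = v.1 m := by simp [hl, hlm]
          rw [huv]
          split_ifs <;> simp
      rw [h1]
      have h2 : (stepMatrix d a i).mulVec c = 0 := hc
      simp [h2]
  ext v
  have := congrFun (hpart (v.1 m)) v
  simpa using this

theorem card_filter_univ_boxLevel (i : ℕ) (p : (Fin n →₀ ℕ) → Prop) [DecidablePred p] :
    (Finset.univ.filter fun v : boxLevel d i => p v.1).card = ((boxLevel d i).filter p).card := by
  rw [← Finset.card_map (Function.Embedding.subtype _)]
  congr 1
  ext v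
  simp [and_comm]

/-- A linear form is not a Lefschetz element when two families of exponents, both preserved by it,
force by their sizes a kernel and a cokernel in the same degree. -/
theorem not_isLefschetzElement {a : Fin n → k} (p q : (Fin n →₀ ℕ) → Prop) [DecidablePred p]
    [DecidablePred q]
    (hp : ∀ v l, a l ≠ 0 → (p (v + Finsupp.single l 1) ↔ p v))
    (hq : ∀ v l, a l ≠ 0 → (q (v + Finsupp.single l 1) ↔ q v)) {i : ℕ}
    (hcp : ((boxLevel d (i + 1)).filter p).card < ((boxLevel d i).filter p).card)
    (hcq : ((boxLevel d i).filter q).card < ((boxLevel d (i + 1)).filter q).card) :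
    ¬ IsLefschetzElement (monomialCI k d) (linearForm a) (linearForm_isHomogeneous a) := by
  rw [isLefschetzElement_iff]
  intro h
  rw [← card_filter_univ_boxLevel, ← card_filter_univ_boxLevel] at hcp hcq
  rcases h i with h | h
  · refine not_injective_mulVec_of_card_lt (fun u v hv hne => ?_) hcp h
    obtain ⟨l, hl, hal⟩ := stepMatrix_ne_zero hne
    simp only [Finset.mem_filter, Finset.mem_univ, true_and] at hv ⊢
    rw [hl]
    exact (hp _ _ hal).2 hv
  · refine not_surjective_mulVec_of_card_lt (fun u hu v hne => ?_) hcq h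
    obtain ⟨l, hl, hal⟩ := stepMatrix_ne_zero hne
    simp only [Finset.mem_filter, Finset.mem_univ, true_and] at hu ⊢
    rw [hl] at hu
    exact (hq _ _ hal).1 hu

theorem mem_affineCone_of_not_isLefschetzElement {a : Fin n → k}
    (h : ¬ IsLefschetzElement (monomialCI k d) (linearForm a) (linearForm_isHomogeneous a)) :
    a ∈ affineCone (nonLefschetzLocus (monomialCI k d)) :=
  fun ha => ⟨a, ha, rfl, h⟩

/-- A nonzero point of the cone has a multiple that is not a Lefschetz element; only its zero
coordinates matter in what follows. -/
theorem exists_not_isLefschetzElement {a : Fin n → k} (ha : a ≠ 0)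
    (h : a ∈ affineCone (nonLefschetzLocus (monomialCI k d))) :
    ∃ a' : Fin n → k, (∀ j, a j ≠ 0 → a' j ≠ 0) ∧
      ¬ IsLefschetzElement (monomialCI k d) (linearForm a') (linearForm_isHomogeneous a') := by
  obtain ⟨a', ha', heq, hl⟩ := h ha
  obtain ⟨c, hc⟩ := (Projectivization.mk_eq_mk_iff k _ _ ha' ha).1 heq
  refine ⟨a', fun j hj => ?_, hl⟩
  rw [← hc, Pi.smul_apply, Units.smul_def, smul_eq_mul]
  exact mul_ne_zero c.ne_zero hj

/-- A polynomial vanishing on a coordinate subspace lies in the ideal of the coordinates that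
define it. -/
theorem mem_span_X_of_vanish [Infinite k] (Z : Finset (Fin n)) {f : MvPolynomial (Fin n) k}
    (hf : ∀ a : Fin n → k, (∀ j ∈ Z, a j = 0) → eval a f = 0) :
    f ∈ Ideal.span ((X : Fin n → MvPolynomial (Fin n) k) '' Z) := by
  set φ : MvPolynomial (Fin n) k →ₐ[k] MvPolynomial (Fin n) k :=
    aeval fun j => if j ∈ Z then 0 else X j
  have h0 : φ f = 0 := by
    refine MvPolynomial.funext fun x => ?_
    rw [map_zero, ← hf (fun j => if j ∈ Z then 0 else x j) fun j hj => if_pos hj]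
    have : ((aeval x).comp φ : MvPolynomial (Fin n) k →ₐ[k] k) =
        aeval fun j => if j ∈ Z then 0 else x j := by
      ext j
      simp only [φ, AlgHom.comp_apply, aeval_X]
      split_ifs <;> simp
    simpa [aeval_eq_eval] using DFunLike.congr_fun this f
  set J := Ideal.span ((X : Fin n → MvPolynomial (Fin n) k) '' Z)
  have h1 : (Ideal.Quotient.mkₐ k J).comp φ = Ideal.Quotient.mkₐ k J := by
    ext j
    simp only [φ, AlgHom.comp_apply, aeval_X]
    split_ifs with hj
    · rw [map_zero]
      exact (Ideal.Quotient.eq_zero_iff_mem.2 (Ideal.subset_span (Set.mem_image_of_mem X hj))).symm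
    · rfl
  have h2 := DFunLike.congr_fun h1 f
  rw [AlgHom.comp_apply, h0, map_zero] at h2
  exact Ideal.Quotient.eq_zero_iff_mem.1 h2.symm

theorem projCodim_le [Infinite k] (Z : Finset (Fin n))
    (h : ∀ a : Fin n → k, (∀ j ∈ Z, a j = 0) →
      a ∈ affineCone (nonLefschetzLocus (monomialCI k d))) :
    projCodim (nonLefschetzLocus (monomialCI k d)) ≤ Z.card := by
  classical
  set J := Ideal.span ((X : Fin n → MvPolynomial (Fin n) k) '' Z)
  have hle : vanishingIdeal k (affineCone (nonLefschetzLocus (monomialCI k d))) ≤ J := by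
    intro f hf
    refine mem_span_X_of_vanish Z fun a ha => ?_
    simpa [aeval_eq_eval] using mem_vanishingIdeal_iff.1 hf a (h a ha)
  have hJ : J ≠ ⊤ := by
    intro htop
    have h1 : (1 : MvPolynomial (Fin n) k) ∈ J := htop ▸ Submodule.mem_top
    have h2 : J ≤ RingHom.ker (eval (0 : Fin n → k)) := by
      refine Ideal.span_le.2 ?_
      rintro _ ⟨j, -, rfl⟩
      simp [RingHom.mem_ker]
    simpa [RingHom.mem_ker] using h2 h1
  refine (Ideal.height_mono hle).trans ((Ideal.height_le_spanFinrank J hJ).trans ?_)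
  refine Nat.cast_le.2 ((Submodule.spanFinrank_span_le_ncard_of_finite ?_).trans ?_)
  · exact Z.finite_toSet.image _
  · exact (Set.ncard_image_le Z.finite_toSet).trans (Set.ncard_coe_finset Z).le

theorem projCodim_eq_one [CharZero k] (hn : 1 ≤ n) (hd : ∀ j, 2 ≤ d j)
    (h1 : ¬ ((∀ j, d j = 2) ∧ Even n)) (h2 : ¬ (n = 2 ∧ ∀ j j', d j = d j')) :
    projCodim (nonLefschetzLocus (monomialCI k d)) = 1 := by
  apply le_antisymm
  · obtain ⟨j, i, b, hb, hdesc, hasc⟩ := exists_descent_and_ascent hn hd h1 h2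
    have h := projCodim_le (k := k) (d := d) {j} fun a ha => ?_
    · simpa using h
    have haj : ∀ l, a l ≠ 0 → l ≠ j := by
      rintro l hl rfl
      exact hl (ha l (Finset.mem_singleton_self l))
    have hinv : ∀ (c : ℕ) (v : Fin n →₀ ℕ) (l : Fin n), a l ≠ 0 →
        ((v + Finsupp.single l 1 : Fin n →₀ ℕ) j = c ↔ v j = c) := by
      intro c v l hl
      simp [haj l hl]
    refine mem_affineCone_of_not_isLefschetzElement
      (not_isLefschetzElement (fun v => v j = 0) (fun v => v j = b) (hinv 0) (hinv b) (i := i)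
        ?_ ?_)
    · have h0 : 0 < d j := by have := hd j; omega
      have e1 := card_filter_coord_eq j h0 i
      have e2 := card_filter_coord_eq j h0 (i + 1)
      rw [Nat.cast_zero, sub_zero] at e1 e2
      rw [← e1, ← e2] at hdesc
      exact_mod_cast hdesc
    · rw [← card_filter_coord_eq j hb i, ← card_filter_coord_eq j hb (i + 1)] at hasc
      exact_mod_cast hasc
  · rw [projCodim, Order.one_le_iff_ne_zero, Ne, Ideal.height_eq_zero_iff_eq_bot]
    intro hbot
    have hmem : (∏ j, X j : MvPolynomial (Fin n) k) ∈
        vanishingIdeal k (affineCone (nonLefschetzLocus (monomialCI k d))) := by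
      refine mem_vanishingIdeal_iff.2 fun a ha => ?_
      rw [map_prod]
      by_contra hne
      have hne' : ∀ j, a j ≠ 0 := fun j => by
        have := Finset.prod_ne_zero_iff.1 hne j (Finset.mem_univ j)
        simpa using this
      have ha0 : a ≠ 0 := fun h => hne' ⟨0, hn⟩ (by rw [h]; rfl)
      obtain ⟨a', ha', hl⟩ := exists_not_isLefschetzElement ha0 ha
      exact hl (isLefschetzElement_of_forall_ne_zero hd fun j => ha' j (hne' j))
    rw [hbot, Ideal.mem_bot, Finset.prod_eq_zero_iff] at hmem
    obtain ⟨j, -, hj⟩ := hmem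
    exact X_ne_zero j hj

/-- The chain of primes is `0 ⊂ (X_i) ⊂ P`. -/
theorem two_le_height_of_X_mem {P : Ideal (MvPolynomial (Fin n) k)} [P.IsPrime] {i j : Fin n}
    (hij : i ≠ j) (hi : X i ∈ P) (hj : X j ∈ P) : 2 ≤ P.height := by
  have hprime : (Ideal.span {(X i : MvPolynomial (Fin n) k)}).IsPrime :=
    (Ideal.span_singleton_prime (X_ne_zero i)).2 X_prime
  have h1 : (⊥ : Ideal (MvPolynomial (Fin n) k)) < Ideal.span {X i} := by
    rw [bot_lt_iff_ne_bot, Ne, Ideal.span_singleton_eq_bot]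
    exact X_ne_zero i
  have h2 : Ideal.span {X i} < P := by
    refine lt_of_le_of_ne ((Ideal.span_singleton_le_iff_mem _).2 hi) fun h => ?_
    rw [← h, Ideal.mem_span_singleton, X_dvd_X] at hj
    exact hij hj
  have h3 := Ideal.height_add_one_le_of_lt_of_isPrime h1
  have h4 := Ideal.height_add_one_le_of_lt_of_isPrime h2
  calc (2 : ℕ∞) = 0 + 1 + 1 := by norm_num
    _ ≤ (Ideal.span {(X i : MvPolynomial (Fin n) k)}).height + 1 := by
        gcongr
        exact le_trans (by gcongr; exact bot_le) h3
    _ ≤ P.height := h4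

theorem projCodim_eq_two [CharZero k] (hn : 1 ≤ n) (hd : ∀ j, d j = 2) (heven : Even n) :
    projCodim (nonLefschetzLocus (monomialCI k d)) = 2 := by
  have hn2 : 2 ≤ n := by
    obtain ⟨r, hr⟩ := heven
    omega
  apply le_antisymm
  · let j : Fin n := ⟨0, by omega⟩
    let j' : Fin n := ⟨1, by omega⟩
    have hjj : j ≠ j' := by simp [j, j']
    have h := projCodim_le (k := k) (d := d) {j, j'} fun a ha => ?_
    · rwa [Finset.card_pair hjj] at h
    have haj : ∀ l, a l ≠ 0 → l ≠ j ∧ l ≠ j' := by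
      intro l hl
      constructor <;> rintro rfl <;> exact hl (ha _ (by simp))
    have hinv : ∀ (c c' : ℕ) (v : Fin n →₀ ℕ) (l : Fin n), a l ≠ 0 →
        (((v + Finsupp.single l 1 : Fin n →₀ ℕ) j = c ∧
          (v + Finsupp.single l 1 : Fin n →₀ ℕ) j' = c') ↔
          (v j = c ∧ v j' = c')) := by
      intro c c' v l hl
      simp [haj l hl]
    obtain ⟨r, hr⟩ := heven
    obtain ⟨c, rfl⟩ : ∃ c, r = c + 1 := ⟨r - 1, by omega⟩
    set s := (Finset.univ.erase j).erase j' with hs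
    have hcard : s.card = n - 2 := by
      rw [hs, Finset.card_erase_of_mem (Finset.mem_erase.2 ⟨hjj.symm, Finset.mem_univ _⟩),
        Finset.card_erase_of_mem (Finset.mem_univ _), Finset.card_univ, Fintype.card_fin]
      omega
    have hD : ∀ l ∈ s, d l ≤ if c = 0 then 1 else 2 := by
      intro l hl
      have := Finset.card_pos.2 ⟨l, hl⟩
      rw [if_neg (by omega), hd l]
    have H := isBoxShape_boxSeries (fun j => (hd j).ge) s _ hD
    have hsum : ∑ l ∈ s, ((d l : ℤ) - 1) = 2 * c := by
      simp only [hd]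
      rw [Finset.sum_const, hcard]
      simp only [nsmul_eq_mul]
      push_cast
      omega
    rw [hsum] at H
    have hst := H.strict (c - 1) (by omega) (by omega) (by split_ifs <;> push_cast <;> omega)
    have hlt : ∀ l, 0 < d l ∧ 1 < d l := fun l => by rw [hd l]; omega
    refine mem_affineCone_of_not_isLefschetzElement
      (not_isLefschetzElement (fun v => v j = 0 ∧ v j' = 0) (fun v => v j = 0 ∧ v j' = 1)
        (hinv 0 0) (hinv 0 1) (i := c) ?_ ?_)
    · rw [← Nat.cast_lt (α := ℤ), card_filter_coord_eq_coord_eq hjj (hlt j).1 (hlt j').1,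
        card_filter_coord_eq_coord_eq hjj (hlt j).1 (hlt j').1]
      have e1 : ((c + 1 : ℕ) : ℤ) - (0 : ℕ) - (0 : ℕ) = 2 * c - (c - 1) := by push_cast; ring
      have e2 : (c : ℤ) - (0 : ℕ) - (0 : ℕ) = c - 1 + 1 := by push_cast; ring
      rw [e1, e2, H.symm]
      exact hst
    · rw [← Nat.cast_lt (α := ℤ), card_filter_coord_eq_coord_eq hjj (hlt j).1 (hlt j').2,
        card_filter_coord_eq_coord_eq hjj (hlt j).1 (hlt j').2]
      have e1 : ((c + 1 : ℕ) : ℤ) - (0 : ℕ) - (1 : ℕ) = c - 1 + 1 := by push_cast; ring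
      have e2 : (c : ℤ) - (0 : ℕ) - (1 : ℕ) = c - 1 := by push_cast; ring
      rw [e1, e2]
      exact hst
  · rw [projCodim, Ideal.height_eq_inf_minimalPrimes]
    refine le_iInf₂ fun P hP => ?_
    have hPp : P.IsPrime := hP.1.1
    have hmem : ∀ m, ∃ j, j ≠ m ∧ (X j : MvPolynomial (Fin n) k) ∈ P := by
      intro m
      have hv : (∏ j ∈ Finset.univ.erase m, X j : MvPolynomial (Fin n) k) ∈
          vanishingIdeal k (affineCone (nonLefschetzLocus (monomialCI k d))) := by
        refine mem_vanishingIdeal_iff.2 fun a ha => ?_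
        rw [map_prod]
        by_contra hne
        have hne' : ∀ j, j ≠ m → a j ≠ 0 := fun j hj => by
          have := Finset.prod_ne_zero_iff.1 hne j (Finset.mem_erase.2 ⟨hj, Finset.mem_univ j⟩)
          simpa using this
        have : Nontrivial (Fin n) := Fin.nontrivial_iff_two_le.2 hn2
        obtain ⟨j, hj⟩ := exists_ne m
        have ha0 : a ≠ 0 := fun h => hne' j hj (by rw [h]; rfl)
        obtain ⟨a', ha', hl⟩ := exists_not_isLefschetzElement ha0 ha
        exact hl (isLefschetzElement_of_squares hd heven fun j hj => ha' j (hne' j hj))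
      obtain ⟨j, hj, hjP⟩ := hPp.prod_mem_iff.1 (hP.1.2 hv)
      exact ⟨j, Finset.ne_of_mem_erase hj, hjP⟩
    obtain ⟨i, -, hi⟩ := hmem ⟨0, hn⟩
    obtain ⟨j, hji, hj⟩ := hmem i
    exact two_le_height_of_X_mem hji.symm hi hj

end Locus

/-! ### The ideals of maximal minors of a monomial complete intersection -/

section LocusIdeal

theorem minorIdeal_submatrix_equiv {S ι κ ι' κ' : Type*} [CommRing S] (m : ℕ) (B : Matrix ι κ S)
    (e : ι' ≃ ι) (e' : κ' ≃ κ) : minorIdeal m (B.submatrix e e') = minorIdeal m B := by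
  refine le_antisymm (minorIdeal_submatrix_le m B e e') ?_
  have h := minorIdeal_submatrix_le m (B.submatrix e e') e.symm e'.symm
  simpa using h

theorem minorIdeal_card {S ι : Type*} [CommRing S] [Fintype ι] [DecidableEq ι]
    (B : Matrix ι ι S) : minorIdeal (Fintype.card ι) B = Ideal.span {B.det} := by
  have e := (Fintype.equivFin ι).symm
  apply le_antisymm
  · refine minorIdeal_le fun r c => ?_
    have h : B.submatrix r c = (1 : Matrix ι ι S).submatrix r e * B.submatrix e e *
        (1 : Matrix ι ι S).submatrix e c := by
      rw [Matrix.submatrix_mul_equiv, Matrix.submatrix_mul_equiv, Matrix.one_mul, Matrix.mul_one]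
    rw [h, Matrix.det_mul, Matrix.det_mul, Matrix.det_submatrix_equiv_self]
    exact Ideal.mul_mem_right _ _ (Ideal.mul_mem_left _ _ (Ideal.mem_span_singleton_self _))
  · rw [Ideal.span_singleton_le_iff_mem, ← Matrix.det_submatrix_equiv_self e]
    exact det_submatrix_mem_minorIdeal B _ _

theorem minorIdeal_zero {S ι κ : Type*} [CommRing S] (B : Matrix ι κ S) : minorIdeal 0 B = ⊤ := by
  rw [Ideal.eq_top_iff_one]
  have h := det_submatrix_mem_minorIdeal (m := 0) B Fin.elim0 Fin.elim0
  rwa [Matrix.det_isEmpty] at h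

variable {k : Type*} [Field k] [CharZero k] {n : ℕ} {d : Fin n → ℕ}

theorem locusIdealAt_eq_top {i : ℕ} (hi : ∑ j, (d j - 1) ≤ i) :
    locusIdealAt (monomialCI k d) i = ⊤ := by
  have h : (boxLevel d (i + 1)).card = 0 := by
    rw [boxLevel_eq_empty (by omega), Finset.card_empty]
  rw [locusIdealAt_monomialCI, h, Nat.zero_min, minorIdeal_zero]

theorem locusIdealAt_symm {i i' : ℕ} (hi : i + 1 + i' = ∑ j, (d j - 1)) :
    locusIdealAt (monomialCI k d) i = locusIdealAt (monomialCI k d) i' := by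
  have hi' : i + (i' + 1) = ∑ j, (d j - 1) := by omega
  rw [locusIdealAt_monomialCI, locusIdealAt_monomialCI, ← minorIdeal_transpose,
    stepMatrix_transpose _ hi hi', minorIdeal_submatrix_equiv, card_boxLevel_symm hi,
    card_boxLevel_symm hi', min_comm]

/-- Below the middle degree, the ideals of maximal minors decrease. -/
theorem locusIdealAt_succ_le (hd : ∀ j, 2 ≤ d j) {i : ℕ} (hi : 2 * i + 3 ≤ ∑ j, (d j - 1)) :
    locusIdealAt (monomialCI k d) (i + 1) ≤ locusIdealAt (monomialCI k d) i := by
  have h1 := card_boxLevel_mono hd (i := i) (i' := i + 1) (by omega) (by omega)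
  have h2 := card_boxLevel_mono hd (i := i + 1) (i' := i + 1 + 1) (by omega) (by omega)
  rw [locusIdealAt_monomialCI, locusIdealAt_monomialCI, min_eq_right h1, min_eq_right h2]
  have h3 := minorIdeal_le_of_mul_eq (k := k)
    (stepMatrix d (X : Fin n → MvPolynomial (Fin n) k) (i + 1))
    (stepMatrix d (X : Fin n → MvPolynomial (Fin n) k) i) (stepMatrix d (fun _ => (1 : k)) i)
    (stepMatrix d (fun _ => 1) (i + 1))
    (stepMatrix_mulVec_injective hd (fun _ => one_ne_zero) (by omega)) (by
      rw [stepMatrix_map]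
      simp only [map_one]
      exact stepMatrix_mul_comm _ _ _)
  simpa only [Fintype.card_coe] using h3

theorem locusIdealAt_antitone (hd : ∀ j, 2 ≤ d j) {i i' : ℕ} (h : i ≤ i')
    (hi : 2 * i' + 1 ≤ ∑ j, (d j - 1)) :
    locusIdealAt (monomialCI k d) i' ≤ locusIdealAt (monomialCI k d) i := by
  induction i', h using Nat.le_induction with
  | base => exact le_rfl
  | succ i' h ih => exact (locusIdealAt_succ_le hd (by omega)).trans (ih (by omega))

/-- When the socle degree is odd, the ideal of the non-Lefschetz locus is the one in the middle
degree. -/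
theorem locusIdeal_eq_locusIdealAt (hd : ∀ j, 2 ≤ d j) {i : ℕ}
    (hi : 2 * i + 1 = ∑ j, (d j - 1)) :
    locusIdeal (monomialCI k d) = locusIdealAt (monomialCI k d) i := by
  refine le_antisymm (iInf_le _ i) (le_iInf fun i' => ?_)
  rcases le_or_gt i' i with h | h
  · exact locusIdealAt_antitone hd h hi.le
  · rcases le_or_gt (∑ j, (d j - 1)) i' with h' | h'
    · rw [locusIdealAt_eq_top h']
      exact le_top
    · obtain ⟨i'', he⟩ := Nat.exists_eq_add_of_le (Nat.succ_le_of_lt h')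
      rw [locusIdealAt_symm (i := i') (i' := i'') (by omega)]
      exact locusIdealAt_antitone hd (by omega) hi.le

/-! ### The middle degree for equal exponents -/

/-- The sum of the `j`-th exponents over all monomials of degree `i` in the box. -/
def exponentSum (d : Fin n → ℕ) (i : ℕ) (j : Fin n) : ℕ := ∑ v ∈ boxLevel d i, v j

theorem prod_monomial_boxLevel (k : Type*) [Field k] (i : ℕ) :
    (∏ v : boxLevel d i, monomial v.1 1 : MvPolynomial (Fin n) k) =
      ∏ j, X j ^ exponentSum d i j := by
  have h : ∀ v : Fin n →₀ ℕ, (monomial v 1 : MvPolynomial (Fin n) k) = ∏ j, X j ^ v j := by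
    intro v
    rw [monomial_eq, C_1, one_mul, Finsupp.prod_fintype _ _ (by simp)]
  simp only [h, exponentSum]
  rw [Finset.prod_comm]
  refine Finset.prod_congr rfl fun j _ => ?_
  rw [Finset.prod_pow_eq_pow_sum, Finset.sum_coe_sort (boxLevel d i) fun v => v j]

theorem exponentSum_eq {D : ℕ} (hD : ∀ j, d j = D) (i : ℕ) (j j' : Fin n) :
    exponentSum d i j = exponentSum d i j' := by
  have hmem : ∀ v ∈ boxLevel d i, Finsupp.equivMapDomain (Equiv.swap j j') v ∈ boxLevel d i := by
    intro v hv
    obtain ⟨h1, h2⟩ := mem_boxLevel.1 hv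
    refine mem_boxLevel.2 ⟨?_, fun l => ?_⟩
    · simp only [Finsupp.equivMapDomain_apply]
      rw [← h1]
      exact Equiv.sum_comp (Equiv.swap j j').symm v
    · rw [Finsupp.equivMapDomain_apply, hD, ← hD ((Equiv.swap j j').symm l)]
      exact h2 _
  have hinv : ∀ v : Fin n →₀ ℕ, Finsupp.equivMapDomain (Equiv.swap j j')
      (Finsupp.equivMapDomain (Equiv.swap j j') v) = v := by
    intro v
    ext l
    simp [Finsupp.equivMapDomain_apply]
  refine Finset.sum_nbij' _ _ hmem hmem (fun v _ => hinv v) (fun v _ => hinv v) fun v _ => ?_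
  simp [Finsupp.equivMapDomain_apply]

theorem card_mul_exponentSum {D : ℕ} (hD : ∀ j, d j = D) (i : ℕ) (j : Fin n) :
    n * exponentSum d i j = i * (boxLevel d i).card := by
  have h1 : ∑ l, exponentSum d i l = n * exponentSum d i j := by
    rw [Finset.sum_congr rfl fun l _ => exponentSum_eq hD i l j]
    simp
  rw [← h1]
  simp only [exponentSum]
  rw [Finset.sum_comm, Finset.sum_congr rfl fun v hv => (mem_boxLevel.1 hv).1]
  simp [mul_comm]

/-- For equal exponents and odd socle degree, the determinant of the generic matrix in the middle
degree is a nonzero scalar times a power of `a_1 ⋯ a_n`. Its exponents are read off from the torus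
action and agree by symmetry. -/
theorem exists_locusIdealAt_middle (hn : 1 ≤ n) (hd : ∀ j, 2 ≤ d j) {D : ℕ} (hD : ∀ j, d j = D)
    {i : ℕ} (hi : 2 * i + 1 = ∑ j, (d j - 1)) :
    ∃ α : ℕ, n * α = (boxLevel d i).card ∧ locusIdealAt (monomialCI k d) i =
      Ideal.span {∏ j : Fin n, (X j : MvPolynomial (Fin n) k) ^ α} := by
  have hi1 : i + (i + 1) = ∑ j, (d j - 1) := by omega
  have hcard := card_boxLevel_symm hi1
  let ε := complementEquiv hi1
  let j₀ : Fin n := ⟨0, hn⟩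
  have hs : ∀ i j, exponentSum d i j = exponentSum d i j₀ := fun i j => exponentSum_eq hD i j j₀
  have hc0 := card_mul_exponentSum hD i j₀
  have hc1 := card_mul_exponentSum hD (i + 1) j₀
  rw [← hcard, add_mul, one_mul, ← hc0] at hc1
  obtain ⟨α, hα⟩ : ∃ α, exponentSum d (i + 1) j₀ = exponentSum d i j₀ + α :=
    Nat.exists_eq_add_of_le (Nat.le_of_mul_le_mul_left (by omega) hn)
  rw [hα, mul_add] at hc1
  refine ⟨α, by omega, ?_⟩
  let M := (stepMatrix d (X : Fin n → MvPolynomial (Fin n) k) i).submatrix ε id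
  let N := (stepMatrix d (fun _ => (1 : k)) i).submatrix ε id
  have hN : N.det ≠ 0 := by
    have hinj : Function.Injective N.mulVec := by
      have h1 := stepMatrix_mulVec_injective (a := fun _ => (1 : k)) hd (fun _ => one_ne_zero)
        (i := i) (by omega)
      intro x y hxy
      apply h1
      ext u
      obtain ⟨u', rfl⟩ := ε.surjective u
      exact congrFun hxy u'
    rw [Matrix.mulVec_injective_iff_isUnit, Matrix.isUnit_iff_isUnit_det] at hinj
    exact hinj.ne_zero
  -- the torus action as an identity of matrices; its determinant gives the exponents
  have hMN : M * Matrix.diagonal (fun v => monomial v.1 1) =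
      Matrix.diagonal (fun v => monomial (ε v).1 1) * N.map C := by
    ext1 u v
    rw [Matrix.mul_diagonal, Matrix.diagonal_mul]
    exact stepMatrix_X_mul_monomial i (ε u) v
  have hdet := congrArg Matrix.det hMN
  have hNC : (N.map (C : k →+* MvPolynomial (Fin n) k)).det = C N.det := (RingHom.map_det C N).symm
  rw [Matrix.det_mul, Matrix.det_mul, Matrix.det_diagonal, Matrix.det_diagonal, hNC,
    Equiv.prod_comp ε fun u => (monomial u.1 1 : MvPolynomial (Fin n) k), prod_monomial_boxLevel,
    prod_monomial_boxLevel] at hdet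
  simp only [hs, hα, pow_add, Finset.prod_mul_distrib] at hdet
  have hne : (∏ j : Fin n, (X j : MvPolynomial (Fin n) k) ^ exponentSum d i j₀) ≠ 0 :=
    Finset.prod_ne_zero_iff.2 fun j _ => pow_ne_zero _ (X_ne_zero j)
  have hdet' : M.det = (∏ j : Fin n, (X j : MvPolynomial (Fin n) k) ^ α) * C N.det := by
    apply mul_right_cancel₀ hne
    rw [hdet]
    ring
  rw [locusIdealAt_monomialCI, ← hcard, min_self,
    ← minorIdeal_submatrix_equiv _ _ ε (Equiv.refl _)]
  change minorIdeal _ M = _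
  rw [← Fintype.card_coe (boxLevel d i), minorIdeal_card, hdet']
  exact Ideal.span_singleton_mul_right_unit ((IsUnit.mk0 _ hN).map C) _

theorem card_boxLevel_two (hd : ∀ j, d j = 2) (i : ℕ) : (boxLevel d i).card = n.choose i := by
  have h := card_boxLevel (d := d) i
  rw [intCoeff_natCast, boxSeries] at h
  simp only [hd, Finset.sum_range_succ, Finset.sum_range_zero, pow_zero, pow_one, zero_add,
    Finset.prod_const, Finset.card_univ, Fintype.card_fin, Polynomial.coeff_one_add_X_pow] at h
  exact_mod_cast h

end LocusIdeal

end NonLefschetz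

end

theorem corollary3p5 {k : Type*} [Field k] [IsAlgClosed k] [CharZero k] {n : ℕ} (hn : 1 ≤ n)
    (d : Fin n → ℕ) (hd : ∀ j, 2 ≤ d j) :
    -- codimension two
    ((∀ j, d j = 2) ∧ Even n →
      NonLefschetz.projCodim (NonLefschetz.nonLefschetzLocus (NonLefschetz.monomialCI k d)) = 2) ∧
    -- codimension one in all other cases (two equal exponents `> 2` in two variables left out)
    (¬ ((∀ j, d j = 2) ∧ Even n) → ¬ (n = 2 ∧ ∀ j j', d j = d j') →
      NonLefschetz.projCodim (NonLefschetz.nonLefschetzLocus (NonLefschetz.monomialCI k d)) = 1) ∧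
    -- the defining ideal for equal even exponents and an odd number of variables
    (∀ D : ℕ, (∀ j, d j = D) → Odd n → Even D →
      NonLefschetz.hilbertFunction (NonLefschetz.monomialCI k d) ((n * (D - 1) - 1) / 2) =
        NonLefschetz.hilbertFunction (NonLefschetz.monomialCI k d) ((n * (D - 1) + 1) / 2) ∧
      (∃ α : ℕ,
        n * α =
          NonLefschetz.hilbertFunction (NonLefschetz.monomialCI k d) ((n * (D - 1) - 1) / 2) ∧
        NonLefschetz.locusIdeal (NonLefschetz.monomialCI k d) =
          Ideal.span {∏ j : Fin n, (MvPolynomial.X j : MvPolynomial (Fin n) k) ^ α}) ∧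
      (D = 2 →
        NonLefschetz.hilbertFunction (NonLefschetz.monomialCI k d) ((n * (D - 1) - 1) / 2) =
          n.choose ((n - 1) / 2))) := by
  refine ⟨fun h => NonLefschetz.projCodim_eq_two hn h.1 h.2,
    NonLefschetz.projCodim_eq_one hn hd, fun D hD hnodd hDeven => ?_⟩
  have hD2 : 2 ≤ D := hD ⟨0, hn⟩ ▸ hd ⟨0, hn⟩
  have he : ∑ j, (d j - 1) = n * (D - 1) := by simp [hD]
  obtain ⟨i, hi⟩ : Odd (n * (D - 1)) := hnodd.mul (Nat.Even.sub_odd (by omega) hDeven odd_one)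
  have e1 : (n * (D - 1) - 1) / 2 = i := by omega
  have e2 : (n * (D - 1) + 1) / 2 = i + 1 := by omega
  rw [e1, e2]
  simp only [NonLefschetz.hilbertFunction_monomialCI]
  refine ⟨NonLefschetz.card_boxLevel_symm (by omega), ?_, ?_⟩
  · rw [NonLefschetz.locusIdeal_eq_locusIdealAt hd (i := i) (by omega)]
    exact NonLefschetz.exists_locusIdealAt_middle hn hd hD (by omega)
  · rintro rfl
    rw [NonLefschetz.card_boxLevel_two hD, ← e1]
    simp
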